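/- Let $\mathcal S,\mathcal X,\mathcal Y,\mathcal Z$ be finite alphabets, $p(s)$ a probability distribution on $\mathcal S$, and $p(y,z|x,s)$ a discrete memoryless channel with input $X$, state $S$ and outputs $Y,Z$. For blocklength $n$, the state sequence $S^n$ is i.i.d. according to $p(s)$; a (possibly stochastic) encoder, which knows the whole state sequence, is an arbitrary conditional distribution $p(x^n|s^n)$; and $(S^n,X^n,Y^n,Z^n)$ has joint distribution $$\prod_{i=1}^n p(s_i)\; p(x^n|s^n)\prod_{i=1}^n p(y_i,z_i|x_i,s_i).$$ A pair $(R_a,R_l)\in\mathbb R^2$ is called achievable if for every $\epsilon>0$ and all sufficiently large $n$ there is an encoder with $$\tfrac1n I(S^n;Y^n)\ge R_a-\epsilon,\qquad \tfrac1n I(S^n;Z^n)\le R_l+\epsilon .$$ Let $\mathcal C$ (the trade-off region) be the set of all achievable pairs. For a finite alphabet $\mathcal U$ and a conditional distribution $p(u,x|s)$ on $\mathcal U\times\mathcal X$ given $s\in\mathcal S$, let $(U,S,X,Y,Z)$ have joint distribution $p(s)\,p(u,x|s)\,p(y,z|x,s)$. Let $\mathcal R^3$ be the closure in $\mathbb R^2$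 of the union, over all finite $\mathcal U$ and all $p(u,x|s)$ satisfying $I(U;Y)\ge I(U;S)$, of the sets of all pairs $(R_a,R_l)$ for which there is a real number $R_u$ with $$0\le R_u\le\min\{I(U;Y)-I(U;S),\,H(S|Y,U)\},$$ $$R_a\le I(S;Y,U)+R_u,\qquad R_l\ge\min\{I(U,S;Z),\,I(S;Z,U)+R_u\}.$$ Then $\mathcal R^3\subseteq\mathcal C$. -/

import Mathlib

/-! Probability mass functions on a finite type `α` are functions `p : α → ℝ` with
`p ∈ stdSimplex ℝ α`; random variables on a finite probability space `(Ω, p)` are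
functions on `Ω`. All logarithms are to base 2. -/

namespace StateAmp

noncomputable section

open Classical in
/-- The probability mass function of the random variable `A` on the finite space `(Ω, p)`. -/
def law {Ω α : Type*} [Fintype Ω] (p : Ω → ℝ) (A : Ω → α) (a : α) : ℝ :=
  ∑ ω : Ω, if A ω = a then p ω else 0

/-- Mutual information `I(A;B) = ∑ p(a,b) log (p(a,b) / (p(a) p(b)))`, in bits. -/
def mutualInfo {Ω α β : Type*} [Fintype Ω] [Fintype α] [Fintype β]
    (p : Ω → ℝ) (A : Ω → α) (B : Ω → β) : ℝ :=
  ∑ a : α, ∑ b : β, law p (fun ω => (A ω, B ω)) (a, b) *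
    Real.logb 2 (law p (fun ω => (A ω, B ω)) (a, b) / (law p A a * law p B b))

/-- Conditional entropy `H(A|B) = -∑ p(a,b) log (p(a,b) / p(b))`, in bits. -/
def condEntropy {Ω α β : Type*} [Fintype Ω] [Fintype α] [Fintype β]
    (p : Ω → ℝ) (A : Ω → α) (B : Ω → β) : ℝ :=
  -∑ a : α, ∑ b : β, law p (fun ω => (A ω, B ω)) (a, b) *
    Real.logb 2 (law p (fun ω => (A ω, B ω)) (a, b) / law p B b)

/-- The joint law of `(S^n, X^n, Y^n, Z^n)`: i.i.d. state `pS`, stochastic encoder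
`e s x = p(x^n | s^n)` knowing the whole state sequence, memoryless channel
`W x s (y, z) = p(y, z | x, s)`. -/
def blockLaw {S X Y Z : Type*} (pS : S → ℝ) (W : X → S → Y × Z → ℝ) (n : ℕ)
    (e : (Fin n → S) → (Fin n → X) → ℝ) :
    (Fin n → S) × (Fin n → X) × (Fin n → Y) × (Fin n → Z) → ℝ :=
  fun ⟨s, x, y, z⟩ => (∏ i, pS (s i)) * e s x * ∏ i, W (x i) (s i) (y i, z i)

/-- `(R_a, R_l)` is achievable: for every `ε > 0` and every sufficiently large `n` there is an
encoder with `I(S^n;Y^n)/n ≥ R_a - ε` and `I(S^n;Z^n)/n ≤ R_l + ε`. -/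
def Achievable {S X Y Z : Type*} [Fintype S] [Fintype X] [Fintype Y] [Fintype Z]
    (pS : S → ℝ) (W : X → S → Y × Z → ℝ) (Ra Rl : ℝ) : Prop :=
  ∀ ε : ℝ, 0 < ε → ∃ N : ℕ, ∀ n : ℕ, N ≤ n →
    ∃ e : (Fin n → S) → (Fin n → X) → ℝ,
      (∀ s, e s ∈ stdSimplex ℝ (Fin n → X)) ∧
      Ra - ε ≤ (1 / (n : ℝ)) *
        mutualInfo (blockLaw pS W n e) (fun ω => ω.1) (fun ω => ω.2.2.1) ∧
      (1 / (n : ℝ)) *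
        mutualInfo (blockLaw pS W n e) (fun ω => ω.1) (fun ω => ω.2.2.2) ≤ Rl + ε

/-- The trade-off region `C`. -/
def tradeoffRegion {S X Y Z : Type*} [Fintype S] [Fintype X] [Fintype Y] [Fintype Z]
    (pS : S → ℝ) (W : X → S → Y × Z → ℝ) : Set (ℝ × ℝ) :=
  {R | Achievable pS W R.1 R.2}

/-- The single-letter joint law `p(s) p(u,x|s) p(y,z|x,s)` of `(U, S, X, Y, Z)`. -/
def letterLaw {S X Y Z U : Type*} (pS : S → ℝ) (W : X → S → Y × Z → ℝ) (q : S → U × X → ℝ) :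
    U × S × X × Y × Z → ℝ :=
  fun ⟨u, s, x, y, z⟩ => pS s * q s (u, x) * W x s (y, z)

/-- The rate pairs allowed by one conditional distribution `q s (u, x) = p(u, x | s)`; empty
unless `I(U;Y) ≥ I(U;S)`. -/
def ratePairs {S X Y Z U : Type*} [Fintype S] [Fintype X] [Fintype Y] [Fintype Z] [Fintype U]
    (pS : S → ℝ) (W : X → S → Y × Z → ℝ) (q : S → U × X → ℝ) : Set (ℝ × ℝ) :=
  let p := letterLaw pS W q
  let rU : U × S × X × Y × Z → U := fun ω => ω.1
  let rS : U × S × X × Y × Z → S := fun ω => ω.2.1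
  let rY : U × S × X × Y × Z → Y := fun ω => ω.2.2.2.1
  let rZ : U × S × X × Y × Z → Z := fun ω => ω.2.2.2.2
  {R | mutualInfo p rU rS ≤ mutualInfo p rU rY ∧
    ∃ Ru : ℝ, 0 ≤ Ru ∧
      Ru ≤ min (mutualInfo p rU rY - mutualInfo p rU rS)
        (condEntropy p rS (fun ω => (rY ω, rU ω))) ∧
      R.1 ≤ mutualInfo p rS (fun ω => (rY ω, rU ω)) + Ru ∧
      min (mutualInfo p (fun ω => (rU ω, rS ω)) rZ)
        (mutualInfo p rS (fun ω => (rZ ω, rU ω)) + Ru) ≤ R.2}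

/-- The region `R³`: closure of the union of `ratePairs` over all `p(u,x|s)`, with the auxiliary
`U` ranging over all finite alphabets. -/
def regionR3 {S X Y Z : Type*} [Fintype S] [Fintype X] [Fintype Y] [Fintype Z]
    (pS : S → ℝ) (W : X → S → Y × Z → ℝ) : Set (ℝ × ℝ) :=
  closure {R | ∃ (k : ℕ) (q : S → Fin k × X → ℝ),
    (∀ s, q s ∈ stdSimplex ℝ (Fin k × X)) ∧ R ∈ ratePairs pS W q}

end

end StateAmp

/-! The proof combines random coding, list decoding and two independent bounds on the leakage. The
trade-off region is closed (`isClosed_tradeoffRegion`), so one may fix `p(u,x|s)` and `R_u`.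

Code. Draw about `2^(n(R_u + I(U;S) + 3δ))` codewords i.i.d. from `p(u)`. Each state sequence
independently selects one of the codewords jointly typical with it, and the input is then drawn
letter by letter from `p(x|s,u)`. Rate `I(U;S)` pays for the existence of a typical codeword. The
excess rate `R_u` acts as a random hash of the state: a given codeword is selected by a given good
state with probability at most about `2^(-n R_u)`.

Amplification. Given `y`, list the good states that are jointly typical with `y` and with their own
codeword. For one pair `(u,y)` about `2^(n H(S|Y,U))` states are typical, the hash keeps a fraction
`2^(-n R_u)` of them, and only `2^(O(nδ))` wrong codewords look typical with `y`, because `R_u +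
I(U;S) ≤ I(U;Y)`. The codeword is never decoded uniquely, so equality of the rates does no harm.
`exists_codebook` is the one-shot form of this count, and `exists_block_codebook` inserts
typicality. A list of average size `K` leaves an uncertainty of about `log K` (`le_pairMI_of_list`),
whence `I(S^n;Y^n) ≳ n (H(S) - H(S|Y,U) + R_u) = n (I(S;Y,U) + R_u)`.

Leakage. `I(S^n;Z^n)` is at most the mean of `log (p(z|s,u) / R(z))` for every output law `R`
(`pairMI_le`). The product of `p(z)` yields `n I(U,S;Z)`. The average of `p(z|u)` over the codebook
costs `log N` more and yields `n (R_u + I(U;S) + I(S;Z|U)) = n (R_u + I(S;Z,U))`. Both bounds hold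
for the same code, so the minimum does. `exists_block_map` collects the three estimates;
`achievable_of_mem_ratePairs` translates them back to the block law. -/

namespace StateAmp

noncomputable section

open Finset
open scoped Classical

/-! ### Product weights -/

/-- The product weight `∏ i, v i (F i)` on functions. -/
def prodW {ι κ : Type*} [Fintype ι] (v : ι → κ → ℝ) (F : ι → κ) : ℝ := ∏ i, v i (F i)

lemma prodW_nonneg {ι κ : Type*} [Fintype ι] {v : ι → κ → ℝ} (hv : ∀ i k, 0 ≤ v i k)
    (F : ι → κ) : 0 ≤ prodW v F :=
  Finset.prod_nonneg fun i _ => hv i (F i)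

section prodW

variable {ι κ : Type*} [Fintype ι] [DecidableEq ι] [Fintype κ]

lemma sum_prodW (v : ι → κ → ℝ) : ∑ F : ι → κ, prodW v F = ∏ i, ∑ k, v i k := by
  simp only [prodW]
  rw [Finset.prod_univ_sum, Fintype.piFinset_univ]

lemma prodW_mem_stdSimplex {v : ι → κ → ℝ} (hv : ∀ i, v i ∈ stdSimplex ℝ κ) :
    prodW v ∈ stdSimplex ℝ (ι → κ) := by
  refine ⟨prodW_nonneg fun i k => (hv i).1 k, ?_⟩
  rw [sum_prodW]
  exact Finset.prod_eq_one fun i _ => (hv i).2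

lemma sum_prodW_mul_prod (v G : ι → κ → ℝ) :
    ∑ F : ι → κ, prodW v F * ∏ i, G i (F i) = ∏ i, ∑ k, v i k * G i k := by
  rw [← sum_prodW]
  simp only [prodW, Finset.prod_mul_distrib]

/-- The other coordinates integrate to one: apply the product formula to a test function equal to
`1` off `i`. -/
lemma sum_prodW_apply {v : ι → κ → ℝ} (hv : ∀ i, ∑ k, v i k = 1) (i : ι) (g : κ → ℝ) :
    ∑ F : ι → κ, prodW v F * g (F i) = ∑ k, v i k * g k := by
  have h := sum_prodW_mul_prod v (fun j k => if j = i then g k else 1)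
  simp only [Finset.prod_ite_eq', Finset.mem_univ, if_true] at h
  rw [h, ← Finset.mul_prod_erase _ _ (Finset.mem_univ i), Finset.prod_eq_one]
  · simp
  · intro j hj
    simp [Finset.ne_of_mem_erase hj, hv]

lemma sum_prodW_apply_mul {v : ι → κ → ℝ} (hv : ∀ i, ∑ k, v i k = 1) {i j : ι} (hij : i ≠ j)
    (g h : κ → ℝ) :
    ∑ F : ι → κ, prodW v F * (g (F i) * h (F j)) =
      (∑ k, v i k * g k) * ∑ k, v j k * h k := by
  have H := sum_prodW_mul_prod v
    (fun l k => (if l = i then g k else 1) * (if l = j then h k else 1))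
  simp only [Finset.prod_mul_distrib, Finset.prod_ite_eq', Finset.mem_univ, if_true] at H
  rw [H, ← Finset.mul_prod_erase _ _ (Finset.mem_univ i),
    ← Finset.mul_prod_erase _ _ (Finset.mem_erase.2 ⟨hij.symm, Finset.mem_univ j⟩),
    Finset.prod_eq_one]
  · simp [hij, hij.symm]
  · intro l hl
    have h1 := Finset.ne_of_mem_erase hl
    have h2 := Finset.ne_of_mem_erase (Finset.mem_of_mem_erase hl)
    simp [h1, h2, hv]

/-- Independence of two coordinates for a function that does not factor; splitting over the value of
`F i` reduces it to products. -/
lemma sum_prodW_apply_pair {v : ι → κ → ℝ} (hv : ∀ i, ∑ k, v i k = 1) {i j : ι} (hij : i ≠ j)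
    (g : κ → κ → ℝ) :
    ∑ F : ι → κ, prodW v F * g (F i) (F j) = ∑ k, ∑ l, v i k * v j l * g k l := by
  have h1 : ∀ F : ι → κ, prodW v F * g (F i) (F j) =
      ∑ k, prodW v F * ((if F i = k then 1 else 0) * g k (F j)) := by
    intro F
    simp
  simp only [h1]
  rw [Finset.sum_comm]
  refine Finset.sum_congr rfl fun k _ => ?_
  rw [sum_prodW_apply_mul hv hij (fun m => if m = k then 1 else 0) (g k)]
  simp [Finset.mul_sum, mul_assoc]

/-- Variances of independent centred variables add, since the cross terms vanish. -/
lemma sum_prodW_sq_sum {v : ι → κ → ℝ} (hv : ∀ i, ∑ k, v i k = 1) (g : ι → κ → ℝ)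
    (hg : ∀ i, ∑ k, v i k * g i k = 0) :
    ∑ F : ι → κ, prodW v F * (∑ i, g i (F i)) ^ 2 = ∑ i, ∑ k, v i k * g i k ^ 2 := by
  have h1 : ∀ F : ι → κ, prodW v F * (∑ i, g i (F i)) ^ 2 =
      ∑ i, ∑ j, prodW v F * (g i (F i) * g j (F j)) := by
    intro F
    rw [sq, Finset.sum_mul_sum, Finset.mul_sum]
    simp only [Finset.mul_sum]
  simp only [h1]
  rw [Finset.sum_comm]
  refine Finset.sum_congr rfl fun i _ => ?_
  rw [Finset.sum_comm, Finset.sum_eq_single i]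
  · rw [sum_prodW_apply hv i (fun k => g i k * g i k)]
    simp only [sq]
  · intro j _ hj
    rw [sum_prodW_apply_mul hv hj.symm, hg, zero_mul]
  · simp

/-- Chebyshev's inequality for a sum of independent variables. -/
lemma sum_prodW_chebyshev {v : ι → κ → ℝ} (hv : ∀ i, v i ∈ stdSimplex ℝ κ) (g : ι → κ → ℝ)
    {B t : ℝ} (ht : 0 < t) (hB : ∑ i, ∑ k, v i k * g i k ^ 2 ≤ B) :
    ∑ F : ι → κ, prodW v F *
      (if t < |∑ i, g i (F i) - ∑ i, ∑ k, v i k * g i k| then 1 else 0) ≤ B / t ^ 2 := by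
  set m : ι → ℝ := fun i => ∑ k, v i k * g i k with hm
  have hv1 : ∀ i, ∑ k, v i k = 1 := fun i => (hv i).2
  have hvar := sum_prodW_sq_sum hv1 (fun i k => g i k - m i) (by
    intro i
    simp only [mul_sub, Finset.sum_sub_distrib, ← Finset.sum_mul, hv1, one_mul]
    simp [hm])
  have hle : ∑ i, ∑ k, v i k * (g i k - m i) ^ 2 ≤ B := by
    refine le_trans (Finset.sum_le_sum fun i _ => ?_) hB
    have : ∑ k, v i k * (g i k - m i) ^ 2 = ∑ k, v i k * g i k ^ 2 - m i ^ 2 := by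
      have e : ∀ k, v i k * (g i k - m i) ^ 2 =
          v i k * g i k ^ 2 - 2 * m i * (v i k * g i k) + m i ^ 2 * v i k := fun k => by ring
      simp only [e, Finset.sum_add_distrib, Finset.sum_sub_distrib, ← Finset.mul_sum, hv1]
      have : ∑ k, v i k * g i k = m i := rfl
      rw [this]; ring
    rw [this]
    nlinarith [sq_nonneg (m i)]
  rw [le_div_iff₀ (by positivity), Finset.sum_mul]
  refine le_trans (le_trans (Finset.sum_le_sum fun F _ => ?_) hvar.le) hle
  rw [mul_assoc]
  refine mul_le_mul_of_nonneg_left ?_ (prodW_nonneg (fun i k => (hv i).1 k) F)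
  rw [Finset.sum_sub_distrib]
  split_ifs with h
  · rw [one_mul, ← sq_abs (_ - _)]
    exact pow_le_pow_left₀ ht.le h.le 2
  · rw [zero_mul]; positivity

lemma exists_le_of_weighted_sum_le {ι : Type*} [Fintype ι] {w f : ι → ℝ} (hw : w ∈ stdSimplex ℝ ι)
    {m : ℝ} (h : ∑ i, w i * f i ≤ m) : ∃ i, 0 < w i ∧ f i ≤ m := by
  by_contra hcon
  push Not at hcon
  have hpos : ∃ i, 0 < w i := by
    by_contra h0
    push Not at h0
    have : ∑ i, w i ≤ 0 := Finset.sum_nonpos fun i _ => h0 i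
    rw [hw.2] at this
    linarith
  have : ∑ i, w i * m < ∑ i, w i * f i := by
    refine Finset.sum_lt_sum (fun i _ => ?_) ?_
    · rcases (hw.1 i).eq_or_lt with h0 | h0
      · rw [← h0]; simp
      · exact mul_le_mul_of_nonneg_left (hcon i h0).le h0.le
    · obtain ⟨i, hi⟩ := hpos
      exact ⟨i, Finset.mem_univ i, mul_lt_mul_of_pos_left (hcon i hi) hi⟩
  rw [← Finset.sum_mul, hw.2, one_mul] at this
  linarith

end prodW

/-! ### Mutual information of a joint mass function -/

/-- Mutual information, in bits, of a joint mass function `P`. -/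
def pairMI {α β : Type*} [Fintype α] [Fintype β] (P : α → β → ℝ) : ℝ :=
  ∑ a, ∑ b, P a b * Real.logb 2 (P a b / ((∑ b', P a b') * ∑ a', P a' b))

lemma law_fst {Ω α β : Type*} [Fintype Ω] [Fintype β] (p : Ω → ℝ) (A : Ω → α) (B : Ω → β)
    (a : α) : law p A a = ∑ b, law p (fun ω => (A ω, B ω)) (a, b) := by
  simp only [law, Prod.mk.injEq]
  rw [Finset.sum_comm]
  refine Finset.sum_congr rfl fun ω _ => ?_
  by_cases h : A ω = a <;> simp [h]

lemma law_snd {Ω α β : Type*} [Fintype Ω] [Fintype α] (p : Ω → ℝ) (A : Ω → α) (B : Ω → β)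
    (b : β) : law p B b = ∑ a, law p (fun ω => (A ω, B ω)) (a, b) := by
  simp only [law, Prod.mk.injEq]
  rw [Finset.sum_comm]
  refine Finset.sum_congr rfl fun ω _ => ?_
  by_cases h : B ω = b <;> simp [h]

lemma mutualInfo_eq_pairMI {Ω α β : Type*} [Fintype Ω] [Fintype α] [Fintype β]
    (p : Ω → ℝ) (A : Ω → α) (B : Ω → β) :
    mutualInfo p A B = pairMI fun a b => law p (fun ω => (A ω, B ω)) (a, b) := by
  simp only [mutualInfo, pairMI, ← law_fst p A B, ← law_snd p A B]

lemma mul_logb_div_ge {a b : ℝ} (ha : 0 ≤ a) (hb : 0 ≤ b) (hab : b = 0 → a = 0) :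
    (a - b) / Real.log 2 ≤ a * Real.logb 2 (a / b) := by
  have h2 : 0 < Real.log 2 := Real.log_pos (by norm_num)
  rcases ha.eq_or_lt with h | h
  · rw [← h]
    simp only [zero_sub, zero_mul]
    exact div_nonpos_of_nonpos_of_nonneg (by linarith) h2.le
  · have hb' : 0 < b := lt_of_le_of_ne hb fun h0 => h.ne' (hab h0.symm)
    rw [Real.logb, ← mul_div_assoc]
    refine div_le_div_of_nonneg_right ?_ h2.le
    have := Real.one_sub_inv_le_log_of_pos (div_pos h hb')
    have h3 := mul_le_mul_of_nonneg_left this h.le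
    have h4 : a * (1 - (a / b)⁻¹) = a - b := by
      field_simp
    linarith

/-- Nonnegativity of relative entropy, from `log x ≥ 1 - 1/x`. Only an inequality between the total
masses is needed, so `b` may be a subprobability. -/
lemma gibbs {ι : Type*} [Fintype ι] {a b : ι → ℝ} (ha : ∀ i, 0 ≤ a i) (hb : ∀ i, 0 ≤ b i)
    (hab : ∀ i, b i = 0 → a i = 0) (hsum : ∑ i, b i ≤ ∑ i, a i) :
    0 ≤ ∑ i, a i * Real.logb 2 (a i / b i) := by
  have h2 : 0 < Real.log 2 := Real.log_pos (by norm_num)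
  refine le_trans ?_ (Finset.sum_le_sum fun i _ => mul_logb_div_ge (ha i) (hb i) (hab i))
  rw [← Finset.sum_div, Finset.sum_sub_distrib]
  exact div_nonneg (by linarith) h2.le

section channel

variable {α β : Type*} [Fintype α] [Fintype β]

/-- Any conditional mass function `Q` gives a lower bound for the mutual information. -/
lemma le_pairMI {p : α → ℝ} (hp : p ∈ stdSimplex ℝ α) {V : α → β → ℝ}
    (hV : ∀ a, V a ∈ stdSimplex ℝ β) {Q : α → β → ℝ} (hQ : ∀ a b, 0 < Q a b)
    (hQ1 : ∀ b, ∑ a, Q a b ≤ 1) :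
    ∑ a, ∑ b, p a * V a b * Real.logb 2 (Q a b / p a) ≤ pairMI fun a b => p a * V a b := by
  have hP0 : ∀ a b, 0 ≤ p a * V a b := fun a b => mul_nonneg (hp.1 a) ((hV a).1 b)
  set r : β → ℝ := fun b => ∑ a, p a * V a b with hr
  have hr0 : ∀ b, 0 ≤ r b := fun b => Finset.sum_nonneg fun a _ => hP0 a b
  have hrz : ∀ a b, r b = 0 → p a * V a b = 0 := fun a b h =>
    (Finset.sum_eq_zero_iff_of_nonneg (fun a _ => hP0 a b)).1 h a (Finset.mem_univ a)
  have hrow : ∀ a, ∑ b, p a * V a b = p a := fun a => by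
    rw [← Finset.mul_sum, (hV a).2, mul_one]
  -- The gap between the two sides is the divergence of the joint law from `Q(a|b) r(b)`.
  have hg := gibbs (ι := α × β) (a := fun i => p i.1 * V i.1 i.2) (b := fun i => Q i.1 i.2 * r i.2)
    (fun i => hP0 _ _) (fun i => mul_nonneg (hQ _ _).le (hr0 _))
    (fun i h => hrz _ _ ((mul_eq_zero.1 h).resolve_left (hQ _ _).ne')) (by
      rw [Fintype.sum_prod_type, Fintype.sum_prod_type]
      simp only [hrow]
      rw [Finset.sum_comm, hp.2]
      calc ∑ b, ∑ a, Q a b * r b ≤ ∑ b, r b := by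
            refine Finset.sum_le_sum fun b _ => ?_
            rw [← Finset.sum_mul]
            exact mul_le_of_le_one_left (hr0 b) (hQ1 b)
        _ = 1 := by
            simp only [hr]
            rw [Finset.sum_comm]
            simp only [hrow]
            exact hp.2)
  rw [Fintype.sum_prod_type] at hg
  have : pairMI (fun a b => p a * V a b) -
      ∑ a, ∑ b, p a * V a b * Real.logb 2 (Q a b / p a) =
      ∑ a, ∑ b, p a * V a b * Real.logb 2 (p a * V a b / (Q a b * r b)) := by
    simp only [pairMI, hrow]
    rw [← Finset.sum_sub_distrib]
    refine Finset.sum_congr rfl fun a _ => ?_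
    rw [← Finset.sum_sub_distrib]
    refine Finset.sum_congr rfl fun b _ => ?_
    rcases (hP0 a b).eq_or_lt with h | h
    · rw [← h]; simp
    · have hrb : r b ≠ 0 := fun h0 => h.ne' (hrz a b h0)
      have hpa : p a ≠ 0 := fun h0 => h.ne' (by rw [h0, zero_mul])
      have hVb : V a b ≠ 0 := fun h0 => h.ne' (by rw [h0, mul_zero])
      have hq := (hQ a b).ne'
      rw [← mul_sub, Real.logb_div h.ne' (mul_ne_zero hpa hrb), Real.logb_div hq hpa,
        Real.logb_div h.ne' (mul_ne_zero hq hrb), Real.logb_mul hpa hrb, Real.logb_mul hq hrb]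
      ring
  linarith

/-- Any positive mass function `R` on the output gives an upper bound for the mutual
information. -/
lemma pairMI_le {p : α → ℝ} (hp : p ∈ stdSimplex ℝ α) {V : α → β → ℝ}
    (hV : ∀ a, V a ∈ stdSimplex ℝ β) {R : β → ℝ} (hR : ∀ b, 0 < R b) (hR1 : ∑ b, R b ≤ 1) :
    (pairMI fun a b => p a * V a b) ≤ ∑ a, p a * ∑ b, V a b * Real.logb 2 (V a b / R b) := by
  have hP0 : ∀ a b, 0 ≤ p a * V a b := fun a b => mul_nonneg (hp.1 a) ((hV a).1 b)
  set r : β → ℝ := fun b => ∑ a, p a * V a b with hr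
  have hr0 : ∀ b, 0 ≤ r b := fun b => Finset.sum_nonneg fun a _ => hP0 a b
  have hrz : ∀ a b, r b = 0 → p a * V a b = 0 := fun a b h =>
    (Finset.sum_eq_zero_iff_of_nonneg (fun a _ => hP0 a b)).1 h a (Finset.mem_univ a)
  have hrow : ∀ a, ∑ b, p a * V a b = p a := fun a => by
    rw [← Finset.mul_sum, (hV a).2, mul_one]
  -- Here the gap is the divergence of the true output law `r` from `R`.
  have hg := gibbs (a := r) (b := R) hr0 (fun i => (hR i).le)
    (fun i h => absurd h (hR i).ne') (by
      refine hR1.trans_eq ?_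
      simp only [hr]
      rw [Finset.sum_comm]
      simp only [hrow]
      exact hp.2.symm)
  have : (∑ a, p a * ∑ b, V a b * Real.logb 2 (V a b / R b)) -
      pairMI (fun a b => p a * V a b) = ∑ b, r b * Real.logb 2 (r b / R b) := by
    simp only [pairMI, hrow]
    have e : ∀ b, r b * Real.logb 2 (r b / R b) =
        ∑ a, p a * V a b * Real.logb 2 (r b / R b) := fun b => by
      rw [← Finset.sum_mul]
    simp only [e]
    conv_rhs => rw [Finset.sum_comm]
    rw [← Finset.sum_sub_distrib]
    refine Finset.sum_congr rfl fun a _ => ?_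
    rw [Finset.mul_sum, ← Finset.sum_sub_distrib]
    refine Finset.sum_congr rfl fun b _ => ?_
    rcases (hP0 a b).eq_or_lt with h | h
    · rw [← h, ← mul_assoc, ← h]; simp
    · have hrb : r b ≠ 0 := fun h0 => h.ne' (hrz a b h0)
      have hpa : p a ≠ 0 := fun h0 => h.ne' (by rw [h0, zero_mul])
      have hVb : V a b ≠ 0 := fun h0 => h.ne' (by rw [h0, mul_zero])
      have hq := (hR b).ne'
      have hrb' : ∑ a', p a' * V a' b = r b := rfl
      rw [hrb', ← mul_assoc, ← mul_sub, Real.logb_div hVb hq,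
        Real.logb_div h.ne' (mul_ne_zero hpa hrb), Real.logb_mul hpa hVb,
        Real.logb_mul hpa hrb, Real.logb_div hrb hq]
      ring
  linarith

end channel

/-! ### A one-shot random coding lemma with list decoding -/

section oneShot

variable {σ υ γ : Type*} [Fintype υ]

/-- The probability that a random codeword is compatible with `s`. -/
def hitMass (Qu : υ → ℝ) (T : σ → υ → Prop) (s : σ) : ℝ := ∑ u, Qu u * if T s u then 1 else 0

/-- The number of codewords compatible with `s`. -/
def hits {N : ℕ} (T : σ → υ → Prop) (c : Fin N → υ) (s : σ) : ℝ :=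
  ∑ k, if T s (c k) then 1 else 0

/-- The state `s` has at least half the expected number of compatible codewords. -/
def GoodState {N : ℕ} (Qu : υ → ℝ) (T : σ → υ → Prop) (TS : σ → Prop) (c : Fin N → υ) (s : σ) :
    Prop := TS s ∧ N * hitMass Qu T s / 2 ≤ hits T c s

/-- The law of the index selected for `s`: uniform over the compatible codewords. -/
def selectW {N : ℕ} (Qu : υ → ℝ) (T : σ → υ → Prop) (TS : σ → Prop) (c : Fin N → υ) (s : σ)
    (k : Fin N) : ℝ :=
  if GoodState Qu T TS c s then (if T s (c k) then 1 else 0) / hits T c s else 1 / N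

lemma ite_one_zero_nonneg (P : Prop) [Decidable P] : (0 : ℝ) ≤ if P then 1 else 0 := by split_ifs <;> norm_num

lemma ite_one_zero_le_one (P : Prop) [Decidable P] : (if P then 1 else 0 : ℝ) ≤ 1 := by split_ifs <;> norm_num

lemma sum_mul_ite_le_one {γ : Type*} [Fintype γ] {V : γ → ℝ} (hV : V ∈ stdSimplex ℝ γ) (P : γ → Prop)
    [DecidablePred P] :
    ∑ y, V y * (if P y then 1 else 0) ≤ 1 := by
  refine le_trans (Finset.sum_le_sum fun y _ => ?_) hV.2.le
  exact mul_le_of_le_one_right (hV.1 y) (ite_one_zero_le_one _)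

lemma sum_mul_ite_nonneg {γ : Type*} [Fintype γ] {V : γ → ℝ} (hV : V ∈ stdSimplex ℝ γ) (P : γ → Prop)
    [DecidablePred P] :
    0 ≤ ∑ y, V y * (if P y then 1 else 0) :=
  Finset.sum_nonneg fun y _ => mul_nonneg (hV.1 y) (ite_one_zero_nonneg _)

variable {N : ℕ} {Qu : υ → ℝ} {T : σ → υ → Prop} {TS : σ → Prop} {a : ℝ}

lemma hits_pos (hN : 0 < N) (ha : 0 < a) (hα : ∀ s, TS s → a ≤ hitMass Qu T s) {c : Fin N → υ}
    {s : σ} (h : GoodState Qu T TS c s) : 0 < hits T c s := by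
  refine lt_of_lt_of_le ?_ h.2
  have h1 := ha.trans_le (hα s h.1)
  have h2 : (0 : ℝ) < N := by exact_mod_cast hN
  positivity

lemma selectW_mem_stdSimplex (hN : 0 < N) (ha : 0 < a) (hα : ∀ s, TS s → a ≤ hitMass Qu T s)
    (c : Fin N → υ) (s : σ) : selectW Qu T TS c s ∈ stdSimplex ℝ (Fin N) := by
  have hN' : (N : ℝ) ≠ 0 := by exact_mod_cast hN.ne'
  by_cases h : GoodState Qu T TS c s
  · have hp := hits_pos hN ha hα h
    refine ⟨fun k => ?_, ?_⟩
    · simp only [selectW, h, if_true]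
      exact div_nonneg (ite_one_zero_nonneg _) hp.le
    · simp only [selectW, h, if_true, ← Finset.sum_div]
      exact div_self hp.ne'
  · refine ⟨fun k => ?_, ?_⟩
    · simp only [selectW, h, if_false]; positivity
    · simp [selectW, h, hN']

/-- Replaces the random denominator `hits` by its mean, so that the bound depends on the codebook
only through `c k` and can be averaged. -/
lemma selectW_le (hN : 0 < N) (ha : 0 < a) (hα : ∀ s, TS s → a ≤ hitMass Qu T s)
    {c : Fin N → υ} {s : σ} (h : GoodState Qu T TS c s) (k : Fin N) :
    selectW Qu T TS c s k ≤ 2 / (N * hitMass Qu T s) * if T s (c k) then 1 else 0 := by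
  have h1 := ha.trans_le (hα s h.1)
  have h2 : (0 : ℝ) < N := by exact_mod_cast hN
  simp only [selectW, h, if_true]
  rw [div_eq_inv_mul]
  refine mul_le_mul_of_nonneg_right ?_ (ite_one_zero_nonneg _)
  rw [show 2 / ((N : ℝ) * hitMass Qu T s) = (N * hitMass Qu T s / 2)⁻¹ by rw [inv_div]]
  exact inv_anti₀ (by positivity) h.2

/-- The hashing estimate: no codeword is favoured by any good state. -/
lemma selectW_le' (hN : 0 < N) (ha : 0 < a) (hα : ∀ s, TS s → a ≤ hitMass Qu T s)
    {c : Fin N → υ} {s : σ} (h : GoodState Qu T TS c s) (k : Fin N) :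
    selectW Qu T TS c s k ≤ 2 / (N * a) := by
  have h1 := hα s h.1
  have h2 : (0 : ℝ) < N := by exact_mod_cast hN
  refine (selectW_le hN ha hα h k).trans ?_
  have h3 := ha.trans_le h1
  refine (mul_le_of_le_one_right (by positivity) (ite_one_zero_le_one _)).trans ?_
  gcongr

variable [Fintype σ] [Fintype γ]

/-- Most states are good for most codebooks. -/
lemma sum_not_goodState_le (hN : 0 < N) (hQ : Qu ∈ stdSimplex ℝ υ) (ha : 0 < a)
    (hα : ∀ s, TS s → a ≤ hitMass Qu T s) {p : σ → ℝ} (hp : p ∈ stdSimplex ℝ σ) {η : ℝ}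
    (hTS : ∑ s, p s * (if TS s then 0 else 1) ≤ η) (hNa : 4 / (N * a) ≤ η) :
    ∑ c : Fin N → υ, prodW (fun _ => Qu) c *
      ∑ s, p s * (if GoodState Qu T TS c s then 0 else 1) ≤ 2 * η := by
  have hN' : (0 : ℝ) < N := by exact_mod_cast hN
  have hW := prodW_mem_stdSimplex (ι := Fin N) (v := fun _ => Qu) fun _ => hQ
  have hη : 0 ≤ η := le_trans (by positivity) hNa
  have key : ∀ s, ∑ c : Fin N → υ, prodW (fun _ => Qu) c *
      (if GoodState Qu T TS c s then 0 else 1) ≤ (if TS s then 0 else 1) + η := by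
    intro s
    by_cases hs : TS s
    · have hπ := ha.trans_le (hα s hs)
      set π := hitMass Qu T s with hπd
      -- The number of hits has mean `N π` and variance at most `N π`; falling below half the mean
      -- has probability at most `4 / (N π)`.
      have hch := sum_prodW_chebyshev (ι := Fin N) (v := fun _ => Qu) (fun _ => hQ)
        (fun _ u => if T s u then 1 else 0) (B := N * π) (t := N * π / 2) (by positivity) (by
          simp [hπd, hitMass])
      have e1 : ∑ _i : Fin N, ∑ u, Qu u * (if T s u then 1 else 0) = N * π := by
        simp [hπd, hitMass]
      rw [e1] at hch
      simp only [hs, if_true, zero_add]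
      refine le_trans (le_trans (Finset.sum_le_sum fun c _ => ?_) hch) ?_
      · refine mul_le_mul_of_nonneg_left ?_ (hW.1 c)
        by_cases hg : GoodState Qu T TS c s
        · simp only [hg, if_true]
          exact ite_one_zero_nonneg _
        · have hlt : hits T c s < N * π / 2 := by
            by_contra hcon
            exact hg ⟨hs, not_lt.1 hcon⟩
          have : N * π / 2 < |∑ i, (if T s (c i) then 1 else 0 : ℝ) - N * π| := by
            change _ < |hits T c s - N * π|
            rw [lt_abs]
            right; linarith
          rw [if_pos this, if_neg hg]
      · have e2 : N * π / (N * π / 2) ^ 2 = 4 / (N * π) := by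
          field_simp
          norm_num
        rw [e2]
        refine le_trans ?_ hNa
        have := hα s hs
        gcongr
    · simp only [hs, if_false]
      refine le_trans (Finset.sum_le_sum fun c _ => mul_le_of_le_one_right (hW.1 c) ?_) ?_
      · split_ifs <;> norm_num
      · rw [hW.2]; linarith
  calc _ = ∑ s, p s * ∑ c : Fin N → υ, prodW (fun _ => Qu) c *
        (if GoodState Qu T TS c s then 0 else 1) := by
        simp only [Finset.mul_sum]
        rw [Finset.sum_comm]
        refine Finset.sum_congr rfl fun s _ => Finset.sum_congr rfl fun c _ => by ring
    _ ≤ ∑ s, p s * ((if TS s then 0 else 1) + η) :=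
        Finset.sum_le_sum fun s _ => mul_le_mul_of_nonneg_left (key s) (hp.1 s)
    _ ≤ 2 * η := by
        simp only [mul_add, Finset.sum_add_distrib, ← Finset.sum_mul, hp.2]
        linarith

/-- The expected number of codewords other than the selected one that are compatible with the
output, for selection from the codebook without regard to the number of compatible codewords. -/
def falseHits {N : ℕ} (p : σ → ℝ) (Qu : υ → ℝ) (V : σ → υ → γ → ℝ) (T : σ → υ → Prop)
    (TS : σ → Prop) (T2 : υ → γ → Prop) (c : Fin N → υ) : ℝ :=
  ∑ s, p s * (if TS s then 1 else 0) * ∑ k, ∑ l, if k = l then 0 else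
    2 / (N * hitMass Qu T s) * (if T s (c k) then 1 else 0) *
      ∑ y, V s (c k) y * (if T2 (c l) y then 1 else 0)

lemma falseHits_nonneg (ha : 0 < a) (hα : ∀ s, TS s → a ≤ hitMass Qu T s) {p : σ → ℝ}
    (hp : p ∈ stdSimplex ℝ σ) {V : σ → υ → γ → ℝ} (hV : ∀ s u, V s u ∈ stdSimplex ℝ γ)
    (T2 : υ → γ → Prop) (c : Fin N → υ) : 0 ≤ falseHits p Qu V T TS T2 c := by
  refine Finset.sum_nonneg fun s _ => ?_
  by_cases hs : TS s
  · have hπ := ha.trans_le (hα s hs)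
    refine mul_nonneg (mul_nonneg (hp.1 s) (ite_one_zero_nonneg _)) ?_
    refine Finset.sum_nonneg fun k _ => Finset.sum_nonneg fun l _ => ?_
    split_ifs
    · exact le_rfl
    · exact mul_nonneg (by positivity) (sum_mul_ite_nonneg (hV _ _) _)
    · simp
  · simp [hs]

/-- For `k ≠ l` the codeword `c l` is independent of `c k` and hence of the output, so it is
compatible with probability at most `β`. The factor `hitMass` cancels, leaving `2β/N` for each of
the `N²` pairs. -/
lemma sum_falseHits_le (hN : 0 < N) (hQ : Qu ∈ stdSimplex ℝ υ) (ha : 0 < a)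
    (hα : ∀ s, TS s → a ≤ hitMass Qu T s) {p : σ → ℝ} (hp : p ∈ stdSimplex ℝ σ)
    {V : σ → υ → γ → ℝ} (hV : ∀ s u, V s u ∈ stdSimplex ℝ γ) {T2 : υ → γ → Prop} {β : ℝ}
    (hβ0 : 0 ≤ β) (hβ : ∀ y, ∑ u, Qu u * (if T2 u y then 1 else 0) ≤ β) :
    ∑ c : Fin N → υ, prodW (fun _ => Qu) c * falseHits p Qu V T TS T2 c ≤ 2 * N * β := by
  have hN' : (0 : ℝ) < N := by exact_mod_cast hN
  have key : ∀ s, TS s → ∀ k l : Fin N, ∑ c : Fin N → υ, prodW (fun _ => Qu) c *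
      (if k = l then 0 else 2 / (N * hitMass Qu T s) * (if T s (c k) then 1 else 0) *
      ∑ y, V s (c k) y * (if T2 (c l) y then 1 else 0)) ≤ 2 * β / N := by
    intro s hs k l
    have hπ := ha.trans_le (hα s hs)
    by_cases hkl : k = l
    · simp only [hkl, if_true, mul_zero, Finset.sum_const_zero]; positivity
    · simp only [hkl, if_false]
      rw [sum_prodW_apply_pair (ι := Fin N) (v := fun _ => Qu) (fun _ => hQ.2) hkl
        (fun u u' => 2 / (N * hitMass Qu T s) * (if T s u then 1 else 0) *
          ∑ y, V s u y * (if T2 u' y then 1 else 0))]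
      calc _ = ∑ u, Qu u * (2 / (N * hitMass Qu T s)) * (if T s u then 1 else 0) *
            ∑ y, V s u y * ∑ u', Qu u' * (if T2 u' y then 1 else 0) := by
            refine Finset.sum_congr rfl fun u _ => ?_
            simp only [Finset.mul_sum]
            rw [Finset.sum_comm]
            refine Finset.sum_congr rfl fun y _ => Finset.sum_congr rfl fun u' _ => ?_
            ring
        _ ≤ ∑ u, Qu u * (2 / (N * hitMass Qu T s)) * (if T s u then 1 else 0) * β := by
            refine Finset.sum_le_sum fun u _ => mul_le_mul_of_nonneg_left ?_ ?_
            · calc _ ≤ ∑ y, V s u y * β :=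
                    Finset.sum_le_sum fun y _ => mul_le_mul_of_nonneg_left (hβ y) ((hV s u).1 y)
                _ = β := by rw [← Finset.sum_mul, (hV s u).2, one_mul]
            · exact mul_nonneg (mul_nonneg (hQ.1 u) (by positivity)) (ite_one_zero_nonneg _)
        _ = 2 / (N * hitMass Qu T s) * hitMass Qu T s * β := by
            rw [← Finset.sum_mul]
            congr 1
            conv_rhs => rw [hitMass, Finset.mul_sum]
            refine Finset.sum_congr rfl fun u _ => ?_
            rw [hitMass]; ring
        _ ≤ 2 * β / N := by
            apply le_of_eq
            field_simp
  calc _ = ∑ s, p s * (if TS s then 1 else 0) * ∑ k, ∑ l, ∑ c : Fin N → υ,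
        prodW (fun _ => Qu) c * (if k = l then 0 else 2 / (N * hitMass Qu T s) *
        (if T s (c k) then 1 else 0) * ∑ y, V s (c k) y * (if T2 (c l) y then 1 else 0)) := by
        simp only [falseHits, Finset.mul_sum (s := (Finset.univ : Finset σ))]
        rw [Finset.sum_comm]
        refine Finset.sum_congr rfl fun s _ => ?_
        simp only [mul_left_comm (prodW _ _) (p s * _), ← Finset.mul_sum]
        congr 1
        simp only [Finset.mul_sum (s := (Finset.univ : Finset (Fin N)))]
        rw [Finset.sum_comm]
        refine Finset.sum_congr rfl fun k _ => ?_
        rw [Finset.sum_comm]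
    _ ≤ ∑ s, p s * (2 * N * β) := by
        refine Finset.sum_le_sum fun s _ => ?_
        by_cases hs : TS s
        · simp only [hs, if_true, mul_one]
          refine mul_le_mul_of_nonneg_left ?_ (hp.1 s)
          calc _ ≤ ∑ _k : Fin N, ∑ _l : Fin N, 2 * β / N :=
                Finset.sum_le_sum fun k _ => Finset.sum_le_sum fun l _ => key s hs k l
            _ = 2 * N * β := by
                simp only [Finset.sum_const, Finset.card_univ, Fintype.card_fin, nsmul_eq_mul]
                field_simp
        · simp only [hs, if_false, mul_zero, zero_mul]
          exact mul_nonneg (hp.1 s) (by positivity)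
    _ = 2 * N * β := by rw [← Finset.sum_mul, hp.2, one_mul]

/-- The expected size of the list of states compatible with the output. -/
def listSize {N : ℕ} (p : σ → ℝ) (V : σ → υ → γ → ℝ) (T3 : σ → υ → γ → Prop) (G : σ → Prop)
    (c : Fin N → υ) (F : σ → Fin N) : ℝ :=
  ∑ s, p s * (if G s then 1 else 0) * ∑ s', ∑ y, V s (c (F s)) y *
    (if G s' ∧ T3 s' (c (F s')) y then 1 else 0)

/-- The true state accounts for the leading `1`. Any other state selects independently and hits
codeword `l` with probability at most `2 / (N a)`; for each `l` compatible with the output at most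
`L` states qualify. The expected number of compatible `l` is at most one for the selected codeword
plus the false hits. -/
lemma sum_selectW_listSize_le (hN : 0 < N) (ha : 0 < a)
    (hα : ∀ s, TS s → a ≤ hitMass Qu T s) {p : σ → ℝ} (hp : p ∈ stdSimplex ℝ σ)
    {V : σ → υ → γ → ℝ} (hV : ∀ s u, V s u ∈ stdSimplex ℝ γ) {T3 : σ → υ → γ → Prop}
    {T2 : υ → γ → Prop} (hT2 : ∀ s u y, T3 s u y → T2 u y) {L : ℝ}
    (hL0 : 0 ≤ L) (hL : ∀ u y, ∑ s, (if T3 s u y then 1 else 0 : ℝ) ≤ L) (c : Fin N → υ) :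
    ∑ F : σ → Fin N, prodW (selectW Qu T TS c) F *
      listSize p V T3 (GoodState Qu T TS c) c F ≤
      1 + 2 * L / (N * a) * (1 + falseHits p Qu V T TS T2 c) := by
  have hN' : (0 : ℝ) < N := by exact_mod_cast hN
  set G := GoodState Qu T TS c with hG
  set sel := selectW Qu T TS c with hsel
  have hlam := selectW_mem_stdSimplex hN ha hα c
  have hW := prodW_mem_stdSimplex hlam
  have pairLe : ∀ s s', ∑ F : σ → Fin N, prodW sel F *
      ∑ y, V s (c (F s)) y * (if G s' ∧ T3 s' (c (F s')) y then 1 else 0) ≤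
      (if s = s' then 1 else 0) + ∑ k, ∑ l, sel s k * (2 / (N * a)) *
        ∑ y, V s (c k) y * (if T3 s' (c l) y then 1 else 0) := by
    intro s s'
    have hnn : 0 ≤ ∑ k, ∑ l, sel s k * (2 / (N * a)) *
        ∑ y, V s (c k) y * (if T3 s' (c l) y then 1 else 0) :=
      Finset.sum_nonneg fun k _ => Finset.sum_nonneg fun l _ =>
        mul_nonneg (mul_nonneg ((hlam s).1 k) (by positivity)) (sum_mul_ite_nonneg (hV _ _) _)
    by_cases hss : s = s'
    · rw [if_pos hss]
      refine le_add_of_le_of_nonneg ?_ hnn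
      refine le_trans (Finset.sum_le_sum fun F _ => ?_) hW.2.le
      exact mul_le_of_le_one_right (hW.1 F) (sum_mul_ite_le_one (hV _ _) _)
    · rw [if_neg hss, zero_add, sum_prodW_apply_pair (fun i => (hlam i).2) hss
        (fun k l => ∑ y, V s (c k) y * (if G s' ∧ T3 s' (c l) y then 1 else 0))]
      refine Finset.sum_le_sum fun k _ => Finset.sum_le_sum fun l _ => ?_
      by_cases hs' : G s'
      · simp only [hs', true_and]
        refine mul_le_mul_of_nonneg_right ?_ (sum_mul_ite_nonneg (hV _ _) _)
        exact mul_le_mul_of_nonneg_left (selectW_le' hN ha hα hs' l) ((hlam s).1 k)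
      · simp only [hs', false_and, if_false, mul_zero, Finset.sum_const_zero]
        exact mul_nonneg (mul_nonneg ((hlam s).1 k) (by positivity)) (sum_mul_ite_nonneg (hV _ _) _)
  have stateLe : ∀ s, G s → ∑ s', ∑ F : σ → Fin N, prodW sel F *
      ∑ y, V s (c (F s)) y * (if G s' ∧ T3 s' (c (F s')) y then 1 else 0) ≤
      1 + 2 * L / (N * a) * (1 + ∑ k, ∑ l, if k = l then 0 else
        2 / (N * hitMass Qu T s) * (if T s (c k) then 1 else 0) *
        ∑ y, V s (c k) y * (if T2 (c l) y then 1 else 0)) := by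
    intro s hs
    refine (Finset.sum_le_sum fun s' _ => pairLe s s').trans ?_
    rw [Finset.sum_add_distrib]
    refine add_le_add (by simp) ?_
    have inner : ∀ k l, ∑ s', ∑ y, V s (c k) y * (if T3 s' (c l) y then 1 else 0) ≤
        L * ∑ y, V s (c k) y * (if T2 (c l) y then 1 else 0) := by
      intro k l
      rw [Finset.sum_comm, Finset.mul_sum]
      refine Finset.sum_le_sum fun y _ => ?_
      rw [← Finset.mul_sum, mul_left_comm]
      refine mul_le_mul_of_nonneg_left ?_ ((hV _ _).1 y)
      by_cases h2 : T2 (c l) y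
      · simp only [h2, if_true, mul_one]
        exact hL _ _
      · have : ∀ s', ¬ T3 s' (c l) y := fun s' h => h2 (hT2 _ _ _ h)
        simp [this, h2]
    calc _ = ∑ k, ∑ l, sel s k * (2 / (N * a)) *
          ∑ s', ∑ y, V s (c k) y * (if T3 s' (c l) y then 1 else 0) := by
          rw [Finset.sum_comm]
          refine Finset.sum_congr rfl fun k _ => ?_
          rw [Finset.sum_comm]
          refine Finset.sum_congr rfl fun l _ => ?_
          rw [Finset.mul_sum]
      _ ≤ ∑ k, ∑ l, sel s k * (2 / (N * a)) *
          (L * ∑ y, V s (c k) y * (if T2 (c l) y then 1 else 0)) :=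
          Finset.sum_le_sum fun k _ => Finset.sum_le_sum fun l _ =>
            mul_le_mul_of_nonneg_left (inner k l) (mul_nonneg ((hlam s).1 k) (by positivity))
      _ = 2 * L / (N * a) * ∑ k, ∑ l, sel s k *
          ∑ y, V s (c k) y * (if T2 (c l) y then 1 else 0) := by
          rw [Finset.mul_sum]
          refine Finset.sum_congr rfl fun k _ => ?_
          rw [Finset.mul_sum]
          refine Finset.sum_congr rfl fun l _ => ?_
          ring
      _ ≤ _ := by
          refine mul_le_mul_of_nonneg_left ?_ (by positivity)
          calc _ ≤ ∑ k, ∑ l, ((if k = l then sel s k else 0) + if k = l then 0 else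
                2 / (N * hitMass Qu T s) * (if T s (c k) then 1 else 0) *
                ∑ y, V s (c k) y * (if T2 (c l) y then 1 else 0)) := by
                refine Finset.sum_le_sum fun k _ => Finset.sum_le_sum fun l _ => ?_
                by_cases hkl : k = l
                · simp only [hkl, if_true, add_zero]
                  exact mul_le_of_le_one_right ((hlam s).1 l) (sum_mul_ite_le_one (hV _ _) _)
                · simp only [hkl, if_false, zero_add]
                  exact mul_le_mul_of_nonneg_right (selectW_le hN ha hα hs k)
                    (sum_mul_ite_nonneg (hV _ _) _)
            _ = _ := by
                simp only [Finset.sum_add_distrib, Finset.sum_ite_eq, Finset.mem_univ, if_true]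
                rw [(hlam s).2]
  calc _ = ∑ s, p s * (if G s then 1 else 0) * ∑ s', ∑ F : σ → Fin N, prodW sel F *
      ∑ y, V s (c (F s)) y * (if G s' ∧ T3 s' (c (F s')) y then 1 else 0) := by
        simp only [listSize, Finset.mul_sum (s := (Finset.univ : Finset σ))]
        rw [Finset.sum_comm]
        refine Finset.sum_congr rfl fun s _ => ?_
        rw [Finset.sum_comm]
        refine Finset.sum_congr rfl fun s' _ => ?_
        rw [Finset.mul_sum]
        refine Finset.sum_congr rfl fun F _ => by ring
    _ ≤ ∑ s, (p s + 2 * L / (N * a) * (p s + p s * (if TS s then 1 else 0) *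
        ∑ k, ∑ l, if k = l then 0 else
        2 / (N * hitMass Qu T s) * (if T s (c k) then 1 else 0) *
        ∑ y, V s (c k) y * (if T2 (c l) y then 1 else 0))) := by
        refine Finset.sum_le_sum fun s _ => ?_
        by_cases hs : G s
        · have hts : TS s := hs.1
          have := mul_le_mul_of_nonneg_left (stateLe s hs) (hp.1 s)
          simp only [hs, hts, if_true, mul_one]
          refine this.trans_eq (by ring)
        · simp only [hs, if_false, mul_zero, zero_mul]
          by_cases hts : TS s
          · have hπ := ha.trans_le (hα s hts)
            have : 0 ≤ ∑ k, ∑ l, if k = l then 0 else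
                2 / (N * hitMass Qu T s) * (if T s (c k) then 1 else 0) *
                ∑ y, V s (c k) y * (if T2 (c l) y then 1 else 0) := by
              refine Finset.sum_nonneg fun k _ => Finset.sum_nonneg fun l _ => ?_
              by_cases hkl : k = l
              · simp [hkl]
              · simp only [hkl, if_false]
                exact mul_nonneg (mul_nonneg (by positivity) (ite_one_zero_nonneg _))
                  (sum_mul_ite_nonneg (hV _ _) _)
            have hps := hp.1 s
            simp only [hts, if_true, mul_one]
            positivity
          · have hps := hp.1 s
            simp only [hts, if_false, mul_zero, zero_mul, add_zero]
            positivity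
    _ = _ := by
        rw [Finset.sum_add_distrib, hp.2, ← Finset.mul_sum, Finset.sum_add_distrib, hp.2]
        rfl

/-- One-shot random coding: there are a codebook `c`, a selection `F` and a set `G` of states of
large probability for which the list of states compatible with the output is short on average. -/
theorem exists_codebook (hN : 0 < N) (hQ : Qu ∈ stdSimplex ℝ υ) (ha : 0 < a)
    (hα : ∀ s, TS s → a ≤ hitMass Qu T s) {p : σ → ℝ} (hp : p ∈ stdSimplex ℝ σ)
    {V : σ → υ → γ → ℝ} (hV : ∀ s u, V s u ∈ stdSimplex ℝ γ) {T3 : σ → υ → γ → Prop}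
    {T2 : υ → γ → Prop} (hT2 : ∀ s u y, T3 s u y → T2 u y) {L β η : ℝ} (hη0 : 0 < η) (hTS : ∑ s, p s * (if TS s then 0 else 1) ≤ η)
    (hNa : 4 / (N * a) ≤ η)
    (hL0 : 0 ≤ L) (hL : ∀ u y, ∑ s, (if T3 s u y then 1 else 0 : ℝ) ≤ L)
    (hβ0 : 0 < β) (hβ : ∀ y, ∑ u, Qu u * (if T2 u y then 1 else 0) ≤ β) :
    ∃ (c : Fin N → υ) (F : σ → Fin N) (G : σ → Prop), (∀ s, G s → T s (c (F s))) ∧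
      ∑ s, p s * (if G s then 0 else 1) ≤ 4 * η ∧
      listSize p V T3 G c F ≤ 1 + 2 * L / (N * a) * (1 + 4 * N * β) := by
  have hN' : (0 : ℝ) < N := by exact_mod_cast hN
  have h1 := sum_not_goodState_le hN hQ ha hα hp hTS hNa
  have h2 := sum_falseHits_le hN hQ ha hα hp hV hβ0.le hβ
  have hW := prodW_mem_stdSimplex (ι := Fin N) (v := fun _ => Qu) fun _ => hQ
  -- Both quantities are normalised to mean at most `1`. Their sum is at most `2` for some `c`, and
  -- each term is nonnegative, so both are bounded at once by twice their mean bounds.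
  obtain ⟨c, -, hc⟩ := exists_le_of_weighted_sum_le hW (m := 2)
    (f := fun c => (∑ s, p s * (if GoodState Qu T TS c s then 0 else 1)) / (2 * η) +
      falseHits p Qu V T TS T2 c / (2 * N * β)) (by
      simp only [mul_add, Finset.sum_add_distrib, ← mul_div_assoc, ← Finset.sum_div]
      have e1 := (div_le_one (by positivity)).2 h1
      have e2 := (div_le_one (by positivity)).2 h2
      linarith)
  have hn1 : 0 ≤ (∑ s, p s * (if GoodState Qu T TS c s then 0 else 1 : ℝ)) / (2 * η) := by
    refine div_nonneg (Finset.sum_nonneg fun s _ => mul_nonneg (hp.1 s) ?_) (by positivity)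
    split_ifs <;> norm_num
  have hn2 : 0 ≤ falseHits p Qu V T TS T2 c / (2 * N * β) :=
    div_nonneg (falseHits_nonneg ha hα hp hV _ c) (by positivity)
  have hA := (div_le_iff₀ (by positivity)).1 ((le_add_of_nonneg_right hn2).trans hc)
  have hB := (div_le_iff₀ (by positivity)).1 ((le_add_of_nonneg_left hn1).trans hc)
  have hlam := selectW_mem_stdSimplex hN ha hα c
  -- Positivity of the weight of `F` is kept: it forces every good state to select a compatible
  -- codeword.
  obtain ⟨F, hF, hFle⟩ := exists_le_of_weighted_sum_le (prodW_mem_stdSimplex hlam)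
    (sum_selectW_listSize_le hN ha hα hp hV hT2 hL0 hL c)
  refine ⟨c, F, GoodState Qu T TS c, fun s hs => ?_, hA.trans_eq (by ring), hFle.trans ?_⟩
  · by_contra hT
    have : selectW Qu T TS c s (F s) = 0 := by simp [selectW, hs, hT]
    exact hF.ne' (Finset.prod_eq_zero (Finset.mem_univ s) this)
  · gcongr
    linarith

end oneShot

/-- If the list of inputs compatible with the output contains the true input with large
probability and is short on average, then the mutual information is large. -/
lemma le_pairMI_of_list {σ γ : Type*} [Fintype σ] [Fintype γ] {p : σ → ℝ}
    (hp : p ∈ stdSimplex ℝ σ) {V : σ → γ → ℝ} (hV : ∀ s, V s ∈ stdSimplex ℝ γ)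
    (A : σ → γ → Prop) {b K : ℝ} (hK1 : 1 ≤ K)
    (hb : ∑ s, p s * ∑ y, V s y * (if A s y then 0 else 1) ≤ b)
    (hK : ∑ s, p s * ∑ y, V s y * ((if A s y then 1 else 0) *
      ∑ s', if A s' y then 1 else 0) ≤ K) :
    -∑ s, p s * Real.logb 2 (p s) -
      (3 + b * Real.logb 2 (Fintype.card σ) + Real.logb 2 K) ≤ pairMI fun s y => p s * V s y := by
  have hne : Nonempty σ := by
    by_contra h
    rw [not_nonempty_iff] at h
    simpa using hp.2
  have hm : (1 : ℝ) ≤ Fintype.card σ := by exact_mod_cast Fintype.card_pos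
  set m : ℝ := ((Fintype.card σ : ℕ) : ℝ) with hmd
  have hlm : 0 ≤ Real.logb 2 m := Real.logb_nonneg (by norm_num) hm
  have hlK : 0 ≤ Real.logb 2 K := Real.logb_nonneg (by norm_num) hK1
  have hlog2 : (1 : ℝ) / 2 ≤ Real.log 2 := by have := Real.log_two_gt_d9; linarith
  set D : γ → ℝ := fun y => ∑ s', if A s' y then 1 else 0 with hD
  have hD0 : ∀ y, 0 ≤ D y := fun y => Finset.sum_nonneg fun s _ => ite_one_zero_nonneg _
  have hDA : ∀ s y, A s y → 1 ≤ D y := by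
    intro s y h
    have := Finset.single_le_sum (f := fun s' => if A s' y then (1 : ℝ) else 0)
      (fun s _ => ite_one_zero_nonneg _) (Finset.mem_univ s)
    simp only [h, if_true] at this
    exact this
  -- Guess of the posterior: half uniform on the list, half uniform on all inputs. The second half
  -- keeps `Q` positive, so an input off the list costs only `1 + log m`.
  set Q : σ → γ → ℝ := fun s y => (if A s y then 1 else 0) / D y / 2 + 1 / (2 * m) with hQ
  have hQ0 : ∀ s y, 0 < Q s y := fun s y => by
    have : 0 ≤ (if A s y then 1 else 0) / D y / 2 :=
      div_nonneg (div_nonneg (ite_one_zero_nonneg _) (hD0 y)) (by norm_num)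
    have : 0 < 1 / (2 * m) := by positivity
    simp only [hQ]; linarith
  have hQ1 : ∀ y, ∑ s, Q s y ≤ 1 := by
    intro y
    simp only [hQ, Finset.sum_add_distrib, ← Finset.sum_div]
    have h1 : D y / D y ≤ 1 := div_self_le_one _
    have h2 : (∑ _s : σ, (1 : ℝ)) / (2 * m) = 1 / 2 := by
      simp only [Finset.sum_const, Finset.card_univ, nsmul_eq_mul, mul_one]
      rw [← hmd]
      field_simp
    rw [h2]
    change D y / D y / 2 + 1 / 2 ≤ 1
    linarith
  refine le_trans ?_ (le_pairMI hp hV hQ0 hQ1)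
  have hlogQ : ∀ s y, -(1 + (if A s y then 0 else 1) * Real.logb 2 m + Real.logb 2 K +
      2 / K * ((if A s y then 1 else 0) * D y)) ≤ Real.logb 2 (Q s y) := by
    intro s y
    by_cases h : A s y
    · have hd := hDA s y h
      have hQl : 1 / (D y * 2) ≤ Q s y := by
        have : 0 < 1 / (2 * m) := by positivity
        simp only [hQ, h, if_true, div_div]
        linarith
      refine le_trans ?_ (Real.logb_le_logb_of_le (by norm_num) (by positivity) hQl)
      rw [Real.logb_div one_ne_zero (by positivity), Real.logb_one,
        Real.logb_mul (by positivity) (by norm_num), Real.logb_self_eq_one (by norm_num)]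
      simp only [h, if_true, zero_mul, one_mul]
      -- A linear bound on the logarithm replaces Jensen's inequality; after averaging it costs `2`,
      -- which with the factor `1/2` in `Q` makes the constant `3`.
      have h3 : Real.logb 2 (D y / K) ≤ 2 / K * D y := by
        have h4 : Real.log (D y / K) ≤ D y / K := by
          have := Real.log_le_sub_one_of_pos (show 0 < D y / K by positivity)
          linarith
        rw [Real.logb, div_le_iff₀ (by linarith)]
        have h5 : 0 ≤ D y / K := by positivity
        have h6 : 2 / K * D y * Real.log 2 = D y / K * (2 * Real.log 2) := by ring
        rw [h6]
        nlinarith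
      rw [Real.logb_div (by positivity) (by positivity)] at h3
      linarith
    · have hQl : 1 / (2 * m) ≤ Q s y := by
        simp [hQ, h]
      refine le_trans ?_ (Real.logb_le_logb_of_le (by norm_num) (by positivity) hQl)
      rw [Real.logb_div one_ne_zero (by positivity), Real.logb_one,
        Real.logb_mul (by positivity) (by positivity), Real.logb_self_eq_one (by norm_num)]
      simp only [h, if_false, zero_mul, one_mul, mul_zero]
      linarith
  have hterm : ∀ s, -(p s * Real.logb 2 (p s)) - p s - p s * Real.logb 2 K -
      Real.logb 2 m * (p s * ∑ y, V s y * (if A s y then 0 else 1)) -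
      2 / K * (p s * ∑ y, V s y * ((if A s y then 1 else 0) * D y)) ≤
      ∑ y, p s * V s y * Real.logb 2 (Q s y / p s) := by
    intro s
    rcases (hp.1 s).eq_or_lt with h0 | h0
    · rw [← h0]; simp
    have e : -(p s * Real.logb 2 (p s)) - p s - p s * Real.logb 2 K -
      Real.logb 2 m * (p s * ∑ y, V s y * (if A s y then 0 else 1)) -
      2 / K * (p s * ∑ y, V s y * ((if A s y then 1 else 0) * D y)) =
      ∑ y, p s * V s y * (-(1 + (if A s y then 0 else 1) * Real.logb 2 m + Real.logb 2 K +
      2 / K * ((if A s y then 1 else 0) * D y)) - Real.logb 2 (p s)) := by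
      have e1 : ∀ y, p s * V s y * (-(1 + (if A s y then 0 else 1) * Real.logb 2 m +
          Real.logb 2 K + 2 / K * ((if A s y then 1 else 0) * D y)) - Real.logb 2 (p s)) =
          (-(p s * Real.logb 2 (p s)) - p s - p s * Real.logb 2 K) * V s y -
          Real.logb 2 m * p s * (V s y * (if A s y then 0 else 1)) -
          2 / K * p s * (V s y * ((if A s y then 1 else 0) * D y)) := fun y => by ring
      simp only [e1, Finset.sum_sub_distrib, ← Finset.mul_sum, (hV s).2]
      ring
    rw [e]
    refine Finset.sum_le_sum fun y _ => mul_le_mul_of_nonneg_left ?_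
      (mul_nonneg h0.le ((hV s).1 y))
    rw [Real.logb_div (hQ0 s y).ne' h0.ne']
    linarith [hlogQ s y]
  refine le_trans ?_ (Finset.sum_le_sum fun s _ => hterm s)
  simp only [Finset.sum_sub_distrib, Finset.sum_neg_distrib, ← Finset.mul_sum, ← Finset.sum_mul,
    hp.2]
  have h7 := mul_le_mul_of_nonneg_left hb hlm
  have h8 : 2 / K * ∑ s, p s * ∑ y, V s y * ((if A s y then 1 else 0) * D y) ≤ 2 := by
    calc _ ≤ 2 / K * K := mul_le_mul_of_nonneg_left hK (by positivity)
      _ = 2 := by field_simp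
  linarith

/-! ### Weak typicality -/

section letters

variable {S U Y : Type*} [Fintype S] [Fintype U] [Fintype Y]

/-- Expectation of `h` under `pS s * κ s u`. -/
def mean2 (pS : S → ℝ) (κ : S → U → ℝ) (h : S → U → ℝ) : ℝ := ∑ s, ∑ u, pS s * κ s u * h s u

/-- Weak joint typicality of `(s, u)` with respect to the finite family `h` of functions. -/
def Typ {J : Type*} (pS : S → ℝ) (κ : S → U → ℝ) (h : J → S → U → ℝ) (δ : ℝ) (n : ℕ)
    (s : Fin n → S) (u : Fin n → U) : Prop :=
  (∀ i, 0 < pS (s i) * κ (s i) (u i)) ∧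
    ∀ j, |∑ i, h j (s i) (u i) - n * mean2 pS κ (h j)| ≤ n * δ

/-- Chebyshev's inequality for each function of the family and a union bound; sequences with a
letter of mass zero carry no weight. -/
lemma sum_not_typ_le {J : Type*} [Fintype J] {pS : S → ℝ} (hpS : pS ∈ stdSimplex ℝ S)
    {κ : S → U → ℝ} (hκ : ∀ s, κ s ∈ stdSimplex ℝ U) (h : J → S → U → ℝ) {δ η : ℝ} (hδ : 0 < δ)
    (hη : 0 < η) : ∃ N₀ : ℕ, ∀ n : ℕ, N₀ ≤ n →
      ∑ s : Fin n → S, prodW (fun _ => pS) s * ∑ u : Fin n → U, prodW (fun i => κ (s i)) u *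
        (if Typ pS κ h δ n s u then 0 else 1) ≤ η := by
  set w : S × U → ℝ := fun a => pS a.1 * κ a.1 a.2 with hw
  have hwS : w ∈ stdSimplex ℝ (S × U) := by
    refine ⟨fun a => mul_nonneg (hpS.1 _) ((hκ _).1 _), ?_⟩
    rw [Fintype.sum_prod_type]
    simp only [hw, ← Finset.mul_sum, (hκ _).2, mul_one, hpS.2]
  set M : J → ℝ := fun j => ∑ a, w a * h j a.1 a.2 ^ 2 with hM
  obtain ⟨N₀, hN₀⟩ := exists_nat_gt ((∑ j, M j) / (δ ^ 2 * η))
  refine ⟨N₀ + 1, fun n hn => ?_⟩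
  have hn0 : (0 : ℝ) < n := by exact_mod_cast (by omega : 0 < n)
  have hnN : (N₀ : ℝ) ≤ n := by exact_mod_cast (by omega : N₀ ≤ n)
  have hch : ∀ j, ∑ F : Fin n → S × U, prodW (fun _ => w) F *
      (if n * δ < |∑ i, h j (F i).1 (F i).2 - n * mean2 pS κ (h j)| then 1 else 0) ≤
      M j / (n * δ ^ 2) := by
    intro j
    have hc := sum_prodW_chebyshev (ι := Fin n) (v := fun _ => w) (fun _ => hwS)
      (fun _ a => h j a.1 a.2) (B := n * M j) (t := n * δ) (by positivity) (by simp [hM])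
    have e1 : ∑ _i : Fin n, ∑ a, w a * h j a.1 a.2 = n * mean2 pS κ (h j) := by
      simp only [Finset.sum_const, Finset.card_univ, Fintype.card_fin, nsmul_eq_mul, mean2, hw]
      rw [Fintype.sum_prod_type]
    rw [e1] at hc
    refine hc.trans_eq ?_
    field_simp
  calc _ = ∑ F : Fin n → S × U, prodW (fun _ => w) F *
        (if Typ pS κ h δ n (fun i => (F i).1) (fun i => (F i).2) then 0 else 1) := by
        rw [← (Equiv.arrowProdEquivProdArrow (Fin n) (fun _ => S) (fun _ => U)).symm.sum_comp,
          Fintype.sum_prod_type]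
        refine Finset.sum_congr rfl fun s _ => ?_
        rw [Finset.mul_sum]
        refine Finset.sum_congr rfl fun u _ => ?_
        rw [← mul_assoc]
        congr 1
        simp only [prodW, hw, ← Finset.prod_mul_distrib]
        rfl
    _ ≤ ∑ F : Fin n → S × U, ∑ j, prodW (fun _ => w) F *
        (if n * δ < |∑ i, h j (F i).1 (F i).2 - n * mean2 pS κ (h j)| then 1 else 0) := by
        refine Finset.sum_le_sum fun F _ => ?_
        have hF0 := prodW_nonneg (fun (_ : Fin n) a => hwS.1 a) F
        rw [← Finset.mul_sum]
        rcases hF0.eq_or_lt with h0 | h0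
        · rw [← h0]; simp
        refine mul_le_mul_of_nonneg_left ?_ hF0
        split_ifs with hT
        · exact Finset.sum_nonneg fun j _ => ite_one_zero_nonneg _
        · have hpos : ∀ i, 0 < w (F i) := fun i => lt_of_le_of_ne (hwS.1 _) fun hz =>
            h0.ne' (Finset.prod_eq_zero (Finset.mem_univ i) hz.symm)
          have : ∃ j, n * δ < |∑ i, h j (F i).1 (F i).2 - n * mean2 pS κ (h j)| := by
            by_contra hcon
            push Not at hcon
            exact hT ⟨hpos, hcon⟩
          obtain ⟨j, hj⟩ := this
          have := Finset.single_le_sum (f := fun j => if n * δ <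
            |∑ i, h j (F i).1 (F i).2 - n * mean2 pS κ (h j)| then (1 : ℝ) else 0)
            (fun j _ => ite_one_zero_nonneg _) (Finset.mem_univ j)
          simp only [hj, if_true] at this
          exact this
    _ ≤ ∑ j, M j / (n * δ ^ 2) := by
        rw [Finset.sum_comm]
        exact Finset.sum_le_sum fun j _ => hch j
    _ ≤ η := by
        rw [← Finset.sum_div, div_le_iff₀ (by positivity)]
        rw [div_lt_iff₀ (by positivity)] at hN₀
        have : (N₀ : ℝ) * (δ ^ 2 * η) ≤ n * (δ ^ 2 * η) := by gcongr
        linarith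

/-- Conditional Chebyshev inequality along a fixed pair of sequences. -/
lemma sum_deviation_le {V : S → U → Y → ℝ} (hV : ∀ s u, V s u ∈ stdSimplex ℝ Y)
    (g : S → U → Y → ℝ) {δ η : ℝ} (hδ : 0 < δ) (hη : 0 < η) : ∃ N₀ : ℕ, ∀ n : ℕ, N₀ ≤ n →
      ∀ (s : Fin n → S) (u : Fin n → U), ∑ y : Fin n → Y, prodW (fun i => V (s i) (u i)) y *
        (if n * δ < |∑ i, g (s i) (u i) (y i) -
          ∑ i, ∑ y, V (s i) (u i) y * g (s i) (u i) y| then 1 else 0) ≤ η := by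
  -- One second-moment bound for all letter pairs makes `N₀` independent of the sequences.
  set M : ℝ := ∑ s, ∑ u, ∑ y, V s u y * g s u y ^ 2 with hM
  have hM0 : ∀ s u, 0 ≤ ∑ y, V s u y * g s u y ^ 2 := fun s u =>
    Finset.sum_nonneg fun y _ => mul_nonneg ((hV s u).1 y) (sq_nonneg _)
  have hMle : ∀ s u, ∑ y, V s u y * g s u y ^ 2 ≤ M := fun s u =>
    (Finset.single_le_sum (f := fun u => ∑ y, V s u y * g s u y ^ 2) (fun u _ => hM0 s u)
      (Finset.mem_univ u)).trans
    (Finset.single_le_sum (f := fun s => ∑ u, ∑ y, V s u y * g s u y ^ 2)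
      (fun s _ => Finset.sum_nonneg fun u _ => hM0 s u) (Finset.mem_univ s))
  obtain ⟨N₀, hN₀⟩ := exists_nat_gt (M / (δ ^ 2 * η))
  refine ⟨N₀ + 1, fun n hn s u => ?_⟩
  have hn0 : (0 : ℝ) < n := by exact_mod_cast (by omega : 0 < n)
  have hnN : (N₀ : ℝ) ≤ n := by exact_mod_cast (by omega : N₀ ≤ n)
  refine (sum_prodW_chebyshev (fun i => hV (s i) (u i)) (fun i y => g (s i) (u i) y)
    (B := n * M) (t := n * δ) (by positivity) ?_).trans ?_
  · refine (Finset.sum_le_sum fun i _ => hMle (s i) (u i)).trans_eq ?_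
    simp
  · rw [div_lt_iff₀ (by positivity)] at hN₀
    rw [div_le_iff₀ (by positivity)]
    have : (N₀ : ℝ) * (δ ^ 2 * η) ≤ n * (δ ^ 2 * η) := by gcongr
    nlinarith

end letters

/-! ### Letter quantities -/

section letters

variable {S U Y : Type*}

/-- Marginal law of `U`. -/
def margU [Fintype S] (pS : S → ℝ) (κ : S → U → ℝ) (u : U) : ℝ := ∑ s, pS s * κ s u

/-- Joint law of `(U, Y)`. -/
def margUY [Fintype S] (pS : S → ℝ) (κ : S → U → ℝ) (V : S → U → Y → ℝ) (u : U) (y : Y) : ℝ :=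
  ∑ s, pS s * κ s u * V s u y

/-- Marginal law of `Y`. -/
def margY [Fintype S] [Fintype U] (pS : S → ℝ) (κ : S → U → ℝ) (V : S → U → Y → ℝ) (y : Y) : ℝ :=
  ∑ u, margUY pS κ V u y

/-- Information density of `(U, S)`. -/
def densUS [Fintype S] (pS : S → ℝ) (κ : S → U → ℝ) (s : S) (u : U) : ℝ :=
  Real.logb 2 (κ s u / margU pS κ u)

/-- Logarithm of the conditional law of `S` given `(U, Y)`. -/
def logPost [Fintype S] (pS : S → ℝ) (κ : S → U → ℝ) (V : S → U → Y → ℝ) (s : S) (u : U)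
    (y : Y) : ℝ := Real.logb 2 (pS s * κ s u * V s u y / margUY pS κ V u y)

/-- Information density of `(U, Y)`. -/
def densUY [Fintype S] [Fintype U] (pS : S → ℝ) (κ : S → U → ℝ) (V : S → U → Y → ℝ) (u : U)
    (y : Y) : ℝ := Real.logb 2 (margUY pS κ V u y / (margU pS κ u * margY pS κ V y))

/-- Conditional expectation of `g` given `(s, u)`. -/
def condMean [Fintype Y] (V : S → U → Y → ℝ) (g : S → U → Y → ℝ) (s : S) (u : U) : ℝ :=
  ∑ y, V s u y * g s u y

variable [Fintype S] [Fintype U] [Fintype Y] {pS : S → ℝ} {κ : S → U → ℝ} {V : S → U → Y → ℝ}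

lemma margU_mem_stdSimplex (hpS : pS ∈ stdSimplex ℝ S) (hκ : ∀ s, κ s ∈ stdSimplex ℝ U) :
    margU pS κ ∈ stdSimplex ℝ U := by
  refine ⟨fun u => Finset.sum_nonneg fun s _ => mul_nonneg (hpS.1 s) ((hκ s).1 u), ?_⟩
  simp only [margU]
  rw [Finset.sum_comm]
  simp only [← Finset.mul_sum, (hκ _).2, mul_one, hpS.2]

lemma joint_nonneg (hpS : pS ∈ stdSimplex ℝ S) (hκ : ∀ s, κ s ∈ stdSimplex ℝ U)
    (hV : ∀ s u, V s u ∈ stdSimplex ℝ Y) (s : S) (u : U) (y : Y) : 0 ≤ pS s * κ s u * V s u y :=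
  mul_nonneg (mul_nonneg (hpS.1 s) ((hκ s).1 u)) ((hV s u).1 y)

lemma margUY_nonneg (hpS : pS ∈ stdSimplex ℝ S) (hκ : ∀ s, κ s ∈ stdSimplex ℝ U)
    (hV : ∀ s u, V s u ∈ stdSimplex ℝ Y) (u : U) (y : Y) : 0 ≤ margUY pS κ V u y :=
  Finset.sum_nonneg fun s _ => joint_nonneg hpS hκ hV s u y

lemma joint_le_margUY (hpS : pS ∈ stdSimplex ℝ S) (hκ : ∀ s, κ s ∈ stdSimplex ℝ U)
    (hV : ∀ s u, V s u ∈ stdSimplex ℝ Y) (s : S) (u : U) (y : Y) :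
    pS s * κ s u * V s u y ≤ margUY pS κ V u y :=
  Finset.single_le_sum (f := fun s => pS s * κ s u * V s u y)
    (fun s _ => joint_nonneg hpS hκ hV s u y) (Finset.mem_univ s)

lemma margUY_le_margY (hpS : pS ∈ stdSimplex ℝ S) (hκ : ∀ s, κ s ∈ stdSimplex ℝ U)
    (hV : ∀ s u, V s u ∈ stdSimplex ℝ Y) (u : U) (y : Y) : margUY pS κ V u y ≤ margY pS κ V y :=
  Finset.single_le_sum (f := fun u => margUY pS κ V u y)
    (fun u _ => margUY_nonneg hpS hκ hV u y) (Finset.mem_univ u)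

lemma mul_le_margU (hpS : pS ∈ stdSimplex ℝ S) (hκ : ∀ s, κ s ∈ stdSimplex ℝ U) (s : S) (u : U) :
    pS s * κ s u ≤ margU pS κ u :=
  Finset.single_le_sum (f := fun s => pS s * κ s u)
    (fun s _ => mul_nonneg (hpS.1 s) ((hκ s).1 u)) (Finset.mem_univ s)

lemma sum_margUY {S U Y : Type*} [Fintype S] [Fintype Y] {pS : S → ℝ} {κ : S → U → ℝ}
    {V : S → U → Y → ℝ} (hV : ∀ s u, V s u ∈ stdSimplex ℝ Y) (u : U) :
    ∑ y, margUY pS κ V u y = margU pS κ u := by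
  simp only [margUY, margU]
  rw [Finset.sum_comm]
  simp only [← Finset.mul_sum, (hV _ _).2, mul_one]

lemma sum_margY (hpS : pS ∈ stdSimplex ℝ S) (hκ : ∀ s, κ s ∈ stdSimplex ℝ U)
    (hV : ∀ s u, V s u ∈ stdSimplex ℝ Y) : ∑ y, margY pS κ V y = 1 := by
  simp only [margY]
  rw [Finset.sum_comm]
  simp only [sum_margUY hV, (margU_mem_stdSimplex hpS hκ).2]

/-! ### Typical triples -/

/-- The typical triples: the conditional law of `s` given `(u, y)` is not too small, and the
information density of `(u, y)` is not too small. -/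
def Typ3 (pS : S → ℝ) (κ : S → U → ℝ) (V : S → U → Y → ℝ) (a b : ℝ) (n : ℕ)
    (s : Fin n → S) (u : Fin n → U) (y : Fin n → Y) : Prop :=
  (∀ i, 0 < pS (s i) * κ (s i) (u i) * V (s i) (u i) (y i)) ∧
    n * a ≤ ∑ i, logPost pS κ V (s i) (u i) (y i) ∧ n * b ≤ ∑ i, densUY pS κ V (u i) (y i)

/-- The typical pairs `(u, y)`. -/
def Typ2 (pS : S → ℝ) (κ : S → U → ℝ) (V : S → U → Y → ℝ) (b : ℝ) (n : ℕ)
    (u : Fin n → U) (y : Fin n → Y) : Prop :=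
  (∀ i, 0 < margUY pS κ V (u i) (y i)) ∧ n * b ≤ ∑ i, densUY pS κ V (u i) (y i)

lemma Typ3.typ2 (hpS : pS ∈ stdSimplex ℝ S) (hκ : ∀ s, κ s ∈ stdSimplex ℝ U)
    (hV : ∀ s u, V s u ∈ stdSimplex ℝ Y) {a b : ℝ} {n : ℕ}
    {s : Fin n → S} {u : Fin n → U} {y : Fin n → Y} (h : Typ3 pS κ V a b n s u y) :
    Typ2 pS κ V b n u y :=
  ⟨fun i => (h.1 i).trans_le (joint_le_margUY hpS hκ hV _ _ _), h.2.2⟩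

lemma prod_eq_rpow_sum_logb {n : ℕ} {x : Fin n → ℝ} (hx : ∀ i, 0 < x i) :
    ∏ i, x i = (2 : ℝ) ^ ∑ i, Real.logb 2 (x i) := by
  rw [Real.rpow_sum_of_pos (by norm_num)]
  exact Finset.prod_congr rfl fun i _ => (Real.rpow_logb (by norm_num) (by norm_num) (hx i)).symm

/-- Each typical `s` has posterior probability at least `2^(n a)` given `(u, y)`, and posteriors sum
to at most one. -/
lemma sum_typ3_le (hpS : pS ∈ stdSimplex ℝ S) (hκ : ∀ s, κ s ∈ stdSimplex ℝ U)
    (hV : ∀ s u, V s u ∈ stdSimplex ℝ Y) (a b : ℝ) (n : ℕ) (u : Fin n → U) (y : Fin n → Y) :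
    ∑ s : Fin n → S, (if Typ3 pS κ V a b n s u y then 1 else 0 : ℝ) ≤ 2 ^ (-(n * a)) := by
  set r : Fin n → S → ℝ := fun i s =>
    pS s * κ s (u i) * V s (u i) (y i) / margUY pS κ V (u i) (y i) with hr
  have hr0 : ∀ i s, 0 ≤ r i s := fun i s =>
    div_nonneg (joint_nonneg hpS hκ hV _ _ _) (margUY_nonneg hpS hκ hV _ _)
  have hr1 : ∀ i, ∑ s, r i s ≤ 1 := fun i => by
    simp only [hr, ← Finset.sum_div]
    exact div_self_le_one _
  calc _ ≤ ∑ s : Fin n → S, 2 ^ (-(n * a)) * prodW r s := by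
        refine Finset.sum_le_sum fun s _ => ?_
        split_ifs with h
        · have hpos : ∀ i, 0 < r i (s i) := fun i => div_pos (h.1 i)
            ((h.1 i).trans_le (joint_le_margUY hpS hκ hV _ _ _))
          rw [prodW, prod_eq_rpow_sum_logb hpos, ← Real.rpow_add (by norm_num)]
          refine Real.one_le_rpow (by norm_num) ?_
          have := h.2.1
          simp only [logPost] at this
          simp only [hr]
          linarith
        · exact mul_nonneg (by positivity) (prodW_nonneg hr0 s)
    _ ≤ 2 ^ (-(n * a)) := by
        rw [← Finset.mul_sum, sum_prodW]
        exact mul_le_of_le_one_right (by positivity)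
          (Finset.prod_le_one (fun i _ => Finset.sum_nonneg fun s _ => hr0 i s) fun i _ => hr1 i)

/-- Change of measure: on typical pairs `p(u) ≤ 2^(-n b) p(u|y)`, and `p(u|y)` sums to at most one.
-/
lemma sum_typ2_le (hpS : pS ∈ stdSimplex ℝ S) (hκ : ∀ s, κ s ∈ stdSimplex ℝ U)
    (hV : ∀ s u, V s u ∈ stdSimplex ℝ Y) (b : ℝ) (n : ℕ) (y : Fin n → Y) :
    ∑ u : Fin n → U, prodW (fun _ => margU pS κ) u *
      (if Typ2 pS κ V b n u y then 1 else 0 : ℝ) ≤ 2 ^ (-(n * b)) := by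
  have hU := margU_mem_stdSimplex hpS hκ
  have hY0 : ∀ y, 0 ≤ margY pS κ V y := fun y =>
    Finset.sum_nonneg fun u _ => margUY_nonneg hpS hκ hV u y
  set r : Fin n → U → ℝ := fun i u => margUY pS κ V u (y i) / margY pS κ V (y i) with hr
  have hr0 : ∀ i s, 0 ≤ r i s := fun i s => div_nonneg (margUY_nonneg hpS hκ hV _ _) (hY0 _)
  have hr1 : ∀ i, ∑ s, r i s ≤ 1 := fun i => by
    simp only [hr, ← Finset.sum_div]
    exact div_self_le_one _
  calc _ ≤ ∑ u : Fin n → U, 2 ^ (-(n * b)) * prodW r u := by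
        refine Finset.sum_le_sum fun u _ => ?_
        split_ifs with h
        · have hy : ∀ i, 0 < margY pS κ V (y i) := fun i =>
            (h.1 i).trans_le (margUY_le_margY hpS hκ hV _ _)
          have hu : ∀ i, 0 < margU pS κ (u i) := fun i => by
            refine (h.1 i).trans_le ?_
            rw [← sum_margUY hV]
            exact Finset.single_le_sum (f := fun y => margUY pS κ V (u i) y)
              (fun y _ => margUY_nonneg hpS hκ hV _ y) (Finset.mem_univ _)
          have hpos : ∀ i, 0 < r i (u i) := fun i => div_pos (h.1 i) (hy i)
          rw [mul_one, prodW, prodW, prod_eq_rpow_sum_logb hpos,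
            prod_eq_rpow_sum_logb fun i => hu i, ← Real.rpow_add (by norm_num)]
          refine Real.rpow_le_rpow_of_exponent_le (by norm_num) ?_
          have h2 := h.2
          have e : ∀ i, Real.logb 2 (r i (u i)) = densUY pS κ V (u i) (y i) +
              Real.logb 2 (margU pS κ (u i)) := fun i => by
            simp only [hr, densUY]
            rw [Real.logb_div (h.1 i).ne' (hy i).ne',
              Real.logb_div (h.1 i).ne' (mul_pos (hu i) (hy i)).ne',
              Real.logb_mul (hu i).ne' (hy i).ne']
            ring
          simp only [e, Finset.sum_add_distrib]
          linarith
        · rw [mul_zero]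
          exact mul_nonneg (by positivity) (prodW_nonneg hr0 u)
    _ ≤ 2 ^ (-(n * b)) := by
        rw [← Finset.mul_sum, sum_prodW]
        exact mul_le_of_le_one_right (by positivity)
          (Finset.prod_le_one (fun i _ => Finset.sum_nonneg fun s _ => hr0 i s) fun i _ => hr1 i)

/-- If `s` is likely to be typical with a conditionally drawn `u`, then an independently drawn `u`
is typical with `s` with probability at least `2 ^ (-n (I(U;S) + δ)) / 2`. -/
lemma le_hitMass (hpS : pS ∈ stdSimplex ℝ S) (hκ : ∀ s, κ s ∈ stdSimplex ℝ U) {J : Type*}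
    {h : J → S → U → ℝ} {j : J} (hj : h j = densUS pS κ) {δ : ℝ} {n : ℕ} {s : Fin n → S}
    (hs : 1 / 2 ≤ ∑ u : Fin n → U, prodW (fun i => κ (s i)) u *
      (if Typ pS κ h δ n s u then 1 else 0)) :
    2 ^ (-(n * (mean2 pS κ (densUS pS κ) + δ))) / 2 ≤
      hitMass (prodW fun _ : Fin n => margU pS κ) (Typ pS κ h δ n) s := by
  set E : ℝ := 2 ^ (-(n * (mean2 pS κ (densUS pS κ) + δ))) with hE
  have hE0 : 0 < E := by positivity
  calc E / 2 = E * (1 / 2) := by ring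
    _ ≤ E * _ := mul_le_mul_of_nonneg_left hs hE0.le
    _ ≤ _ := by
        rw [Finset.mul_sum, hitMass]
        refine Finset.sum_le_sum fun u _ => ?_
        split_ifs with hT
        · have hpos := hT.1
          have hκ0 : ∀ i, 0 < κ (s i) (u i) := fun i =>
            pos_of_mul_pos_right (hpos i) (hpS.1 _)
          have hu : ∀ i, 0 < margU pS κ (u i) := fun i =>
            (hpos i).trans_le (mul_le_margU hpS hκ _ _)
          -- Change of measure: on a typical pair `p(u|s) ≤ 2^(n(I(U;S) + δ)) p(u)`.
          rw [mul_one, mul_one, prodW, prodW, prod_eq_rpow_sum_logb hκ0,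
            prod_eq_rpow_sum_logb hu, hE, ← Real.rpow_add (by norm_num)]
          refine Real.rpow_le_rpow_of_exponent_le (by norm_num) ?_
          have h2 := (abs_le.1 (hT.2 j)).2
          rw [hj] at h2
          have e : ∀ i, densUS pS κ (s i) (u i) = Real.logb 2 (κ (s i) (u i)) -
              Real.logb 2 (margU pS κ (u i)) := fun i =>
            Real.logb_div (hκ0 i).ne' (hu i).ne'
          simp only [e, Finset.sum_sub_distrib] at h2
          linarith
        · simp

/-- The output is typical with a typical pair with large probability. -/
lemma sum_not_typ3_le (hV : ∀ s u, V s u ∈ stdSimplex ℝ Y)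
    {J : Type*} {h : J → S → U → ℝ} {j₁ j₂ : J}
    (hj₁ : h j₁ = condMean V (logPost pS κ V))
    (hj₂ : h j₂ = condMean V fun _ => densUY pS κ V) {δ η : ℝ} (hδ : 0 < δ) (hη : 0 < η) :
    ∃ N₀ : ℕ, ∀ n : ℕ, N₀ ≤ n → ∀ (s : Fin n → S) (u : Fin n → U), Typ pS κ h δ n s u →
      ∑ y : Fin n → Y, prodW (fun i => V (s i) (u i)) y *
        (if Typ3 pS κ V (mean2 pS κ (condMean V (logPost pS κ V)) - 2 * δ)
          (mean2 pS κ (condMean V fun _ => densUY pS κ V) - 2 * δ) n s u y then 0 else 1) ≤ η := by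
  obtain ⟨N₁, hN₁⟩ := sum_deviation_le hV (logPost pS κ V) hδ (half_pos hη)
  obtain ⟨N₂, hN₂⟩ := sum_deviation_le hV (fun _ => densUY pS κ V) hδ (half_pos hη)
  refine ⟨max N₁ N₂, fun n hn s u hT => ?_⟩
  have h1 := hN₁ n (le_of_max_le_left hn) s u
  have h2 := hN₂ n (le_of_max_le_right hn) s u
  rw [← add_halves η]
  refine le_trans ?_ (add_le_add h1 h2)
  rw [← Finset.sum_add_distrib]
  refine Finset.sum_le_sum fun y _ => ?_
  have hW := prodW_nonneg (fun i y => (hV (s i) (u i)).1 y) y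
  rcases hW.eq_or_lt with h0 | h0
  · rw [← h0]; simp
  rw [← mul_add]
  refine mul_le_mul_of_nonneg_left ?_ hW
  split_ifs with hA hB hC hC hB hC hC
  all_goals try norm_num
  apply hA
  have hVpos : ∀ i, 0 < V (s i) (u i) (y i) := fun i => lt_of_le_of_ne ((hV _ _).1 _) fun hz =>
    h0.ne' (Finset.prod_eq_zero (Finset.mem_univ i) hz.symm)
  refine ⟨fun i => mul_pos (hT.1 i) (hVpos i), ?_, ?_⟩
  -- One `δ` comes from the conditional means, controlled by the typicality of `(s, u)`, and one
  -- from the fluctuation of `y` about them.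
  · have e1 := (abs_le.1 (hT.2 j₁)).1
    have e2 := (abs_le.1 (not_lt.1 hB)).1
    rw [hj₁] at e1
    simp only [condMean] at e1 ⊢
    linarith
  · have e1 := (abs_le.1 (hT.2 j₂)).1
    have e2 := (abs_le.1 (not_lt.1 hC)).1
    rw [hj₂] at e1
    simp only [condMean] at e1 ⊢
    linarith

/-! ### Leakage -/

/-- The reference law `R` need not be a product: it suffices that it dominates each product law
`R₀(f s)` up to the factor `M`, at the price of `log M`. -/
lemma pairMI_block_le {S U Y : Type*} [Fintype S] [Fintype Y] {pS : S → ℝ}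
    {V : S → U → Y → ℝ} (hpS : pS ∈ stdSimplex ℝ S) (hV : ∀ s u, V s u ∈ stdSimplex ℝ Y) {n : ℕ}
    (f : (Fin n → S) → Fin n → U) {R₀ : U → Y → ℝ} (hR₀ : ∀ u y, 0 < R₀ u y)
    {R : (Fin n → Y) → ℝ} (hR : ∀ y, 0 < R y) (hR1 : ∑ y, R y ≤ 1) {M : ℝ} (hM : 0 < M)
    (hMR : ∀ s y, prodW (fun i => R₀ (f s i)) y ≤ M * R y) :
    (pairMI fun (s : Fin n → S) (y : Fin n → Y) =>
      prodW (fun _ => pS) s * prodW (fun i => V (s i) (f s i)) y) ≤ Real.logb 2 M +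
      ∑ s : Fin n → S, prodW (fun _ => pS) s *
        ∑ i, condMean V (fun s u y => Real.logb 2 (V s u y / R₀ u y)) (s i) (f s i) := by
  have hP := prodW_mem_stdSimplex (ι := Fin n) (v := fun _ => pS) fun _ => hpS
  have hVn : ∀ s : Fin n → S, prodW (fun i => V (s i) (f s i)) ∈ stdSimplex ℝ (Fin n → Y) :=
    fun s => prodW_mem_stdSimplex fun i => hV _ _
  refine (pairMI_le hP hVn hR hR1).trans ?_
  have key : ∀ s : Fin n → S, ∑ y, prodW (fun i => V (s i) (f s i)) y *
      Real.logb 2 (prodW (fun i => V (s i) (f s i)) y / R y) ≤ Real.logb 2 M +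
      ∑ i, condMean V (fun s u y => Real.logb 2 (V s u y / R₀ u y)) (s i) (f s i) := by
    intro s
    calc _ ≤ ∑ y, prodW (fun i => V (s i) (f s i)) y * (Real.logb 2 M +
          ∑ i, Real.logb 2 (V (s i) (f s i) (y i) / R₀ (f s i) (y i))) := by
          refine Finset.sum_le_sum fun y _ => ?_
          rcases ((hVn s).1 y).eq_or_lt with h0 | h0
          · rw [← h0]; simp
          refine mul_le_mul_of_nonneg_left ?_ h0.le
          have hVpos : ∀ i, 0 < V (s i) (f s i) (y i) := fun i =>
            lt_of_le_of_ne ((hV _ _).1 _) fun hz =>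
              h0.ne' (Finset.prod_eq_zero (Finset.mem_univ i) hz.symm)
          have hRp : 0 < prodW (fun i => R₀ (f s i)) y := Finset.prod_pos fun i _ => hR₀ _ _
          have e1 : ∑ i, Real.logb 2 (V (s i) (f s i) (y i) / R₀ (f s i) (y i)) =
              Real.logb 2 (prodW (fun i => V (s i) (f s i)) y / prodW (fun i => R₀ (f s i)) y) := by
            rw [prodW, prodW, ← Finset.prod_div_distrib, Real.logb_prod]
            exact fun i _ => (div_pos (hVpos i) (hR₀ _ _)).ne'
          rw [e1, ← Real.logb_mul hM.ne' (div_pos h0 hRp).ne']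
          refine Real.logb_le_logb_of_le (by norm_num) (div_pos h0 (hR y)) ?_
          rw [div_le_iff₀ (hR y), mul_div_assoc', div_mul_eq_mul_div, le_div_iff₀ hRp]
          nlinarith [hMR s y]
      _ = _ := by
          simp only [mul_add, Finset.sum_add_distrib, ← Finset.sum_mul, (hVn s).2, one_mul,
            Finset.mul_sum]
          congr 1
          rw [Finset.sum_comm]
          refine Finset.sum_congr rfl fun i _ => ?_
          rw [sum_prodW_apply (fun i => (hV (s i) (f s i)).2) i
            fun y => Real.logb 2 (V (s i) (f s i) y / R₀ (f s i) y)]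
          rfl
  refine (Finset.sum_le_sum fun s _ => mul_le_mul_of_nonneg_left (key s) (hP.1 s)).trans_eq ?_
  simp only [mul_add, Finset.sum_add_distrib, ← Finset.sum_mul, hP.2, one_mul]

/-- The expectation of an additive function is close to its mean if the pair is typical with
large probability. -/
lemma sum_additive_le (hpS : pS ∈ stdSimplex ℝ S) (hκ : ∀ s, κ s ∈ stdSimplex ℝ U) {J : Type*}
    {h : J → S → U → ℝ} (j : J) {C : ℝ} (hC : ∀ s u, |h j s u| ≤ C) {δ b : ℝ} (hδ : 0 ≤ δ) {n : ℕ}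
    {f : (Fin n → S) → Fin n → U} {G : (Fin n → S) → Prop}
    (hG : ∀ s, G s → Typ pS κ h δ n s (f s))
    (hb : ∑ s, prodW (fun _ => pS) s * (if G s then 0 else 1) ≤ b) :
    ∑ s, prodW (fun _ => pS) s * ∑ i, h j (s i) (f s i) ≤
      n * (mean2 pS κ (h j) + δ + 2 * C * b) := by
  have hP := prodW_mem_stdSimplex (ι := Fin n) (v := fun _ => pS) fun _ => hpS
  -- On bad states the sum is at most `n C`, hence exceeds `n` times the mean by at most `2 C n`.
  have hmean : -C ≤ mean2 pS κ (h j) := by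
    calc -C = ∑ s, ∑ u, pS s * κ s u * (-C) := by
          simp only [← Finset.sum_mul, ← Finset.mul_sum, (hκ _).2, mul_one, hpS.2, one_mul]
      _ ≤ _ := Finset.sum_le_sum fun s _ => Finset.sum_le_sum fun u _ =>
          mul_le_mul_of_nonneg_left (abs_le.1 (hC s u)).1 (mul_nonneg (hpS.1 s) ((hκ s).1 u))
  have key : ∀ s : Fin n → S, ∑ i, h j (s i) (f s i) ≤
      n * (mean2 pS κ (h j) + δ) + 2 * C * n * (if G s then 0 else 1) := by
    intro s
    by_cases hs : G s
    · have := (abs_le.1 ((hG s hs).2 j)).2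
      simp only [hs, if_true]
      linarith
    · have : ∑ i, h j (s i) (f s i) ≤ ∑ _i : Fin n, C :=
        Finset.sum_le_sum fun i _ => (abs_le.1 (hC _ _)).2
      simp only [Finset.sum_const, Finset.card_univ, Fintype.card_fin, nsmul_eq_mul] at this
      simp only [hs, if_false]
      have hn : (0 : ℝ) ≤ n := Nat.cast_nonneg n
      nlinarith
  by_cases hn0 : n = 0
  · subst hn0; simp
  have hC0 : 0 ≤ C := by
    have hS : Nonempty S := by
      by_contra hne
      rw [not_nonempty_iff] at hne
      simpa using hpS.2
    have hU : Nonempty U := by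
      by_contra hne
      rw [not_nonempty_iff] at hne
      obtain ⟨s⟩ := hS
      simpa using (hκ s).2
    obtain ⟨s⟩ := hS
    obtain ⟨u⟩ := hU
    exact (abs_nonneg _).trans (hC s u)
  calc _ ≤ ∑ s : Fin n → S, prodW (fun _ => pS) s *
        (n * (mean2 pS κ (h j) + δ) + 2 * C * n * (if G s then 0 else 1)) :=
        Finset.sum_le_sum fun s _ => mul_le_mul_of_nonneg_left (key s) (hP.1 s)
    _ = n * (mean2 pS κ (h j) + δ) +
        2 * C * n * ∑ s, prodW (fun _ => pS) s * (if G s then 0 else 1) := by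
        simp only [mul_add, Finset.sum_add_distrib, ← Finset.sum_mul, hP.2, one_mul]
        rw [Finset.mul_sum]
        congr 1
        refine Finset.sum_congr rfl fun s _ => by ring
    _ ≤ n * (mean2 pS κ (h j) + δ) + 2 * C * n * b := by gcongr
    _ = _ := by ring

/-- Mixing a conditional law with the uniform law costs little relative entropy. -/
lemma mean2_smoothed_le (hpS : pS ∈ stdSimplex ℝ S) (hκ : ∀ s, κ s ∈ stdSimplex ℝ U)
    (hV : ∀ s u, V s u ∈ stdSimplex ℝ Y) {R : U → Y → ℝ}
    (hR : ∀ s u y, 0 < pS s * κ s u * V s u y → 0 < R u y) {t m : ℝ} (ht : t < 1) (hm : 0 ≤ m) :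
    mean2 pS κ (condMean V fun s u y => Real.logb 2 (V s u y / ((1 - t) * R u y + m))) ≤
      mean2 pS κ (condMean V fun s u y => Real.logb 2 (V s u y / R u y)) -
        Real.logb 2 (1 - t) := by
  have ht' : 0 < 1 - t := by linarith
  have e : mean2 pS κ (condMean V fun s u y => Real.logb 2 (V s u y / R u y)) -
      Real.logb 2 (1 - t) =
      mean2 pS κ (condMean V fun s u y =>
        Real.logb 2 (V s u y / R u y) - Real.logb 2 (1 - t)) := by
    simp only [mean2, condMean, mul_sub, Finset.sum_sub_distrib, ← Finset.sum_mul, (hV _ _).2,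
      ← Finset.mul_sum, (hκ _).2, one_mul, mul_one, hpS.2]
  rw [e]
  simp only [mean2, condMean, Finset.mul_sum, ← mul_assoc]
  refine Finset.sum_le_sum fun s _ => Finset.sum_le_sum fun u _ => Finset.sum_le_sum fun y _ => ?_
  rcases (joint_nonneg hpS hκ hV s u y).eq_or_lt with h0 | h0
  · rw [← h0]; simp
  refine mul_le_mul_of_nonneg_left ?_ h0.le
  have hr := hR s u y h0
  have hv : 0 < V s u y := pos_of_mul_pos_right h0 (mul_nonneg (hpS.1 s) ((hκ s).1 u))
  rw [← Real.logb_div (div_pos hv hr).ne' ht'.ne']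
  refine Real.logb_le_logb_of_le (by norm_num) (by positivity) ?_
  rw [div_div]
  refine div_le_div_of_nonneg_left hv.le (by positivity) ?_
  linarith

end letters

/-! ### Existence of a good block map -/

section blocks

lemma mean2_densUS_nonneg {S U : Type*} [Fintype S] [Fintype U] {pS : S → ℝ} {κ : S → U → ℝ}
    (hpS : pS ∈ stdSimplex ℝ S) (hκ : ∀ s, κ s ∈ stdSimplex ℝ U) :
    0 ≤ mean2 pS κ (densUS pS κ) := by
  have hU := margU_mem_stdSimplex hpS hκ
  have hle := mul_le_margU hpS hκ
  have hg := gibbs (ι := S × U) (a := fun i => pS i.1 * κ i.1 i.2)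
    (b := fun i => pS i.1 * margU pS κ i.2) (fun i => mul_nonneg (hpS.1 _) ((hκ _).1 _))
    (fun i => mul_nonneg (hpS.1 _) (hU.1 _)) (fun i hi => by
      rcases mul_eq_zero.1 hi with h | h
      · rw [h, zero_mul]
      · exact le_antisymm (h ▸ hle i.1 i.2) (mul_nonneg (hpS.1 _) ((hκ _).1 _))) (by
      rw [Fintype.sum_prod_type, Fintype.sum_prod_type]
      simp only [← Finset.mul_sum, hU.2, (hκ _).2, le_refl])
  rw [Fintype.sum_prod_type] at hg
  refine hg.trans_eq ?_
  refine Finset.sum_congr rfl fun s _ => Finset.sum_congr rfl fun u _ => ?_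
  by_cases h : pS s = 0
  · simp [h]
  · simp only [densUS]
    rw [mul_div_mul_left _ _ h]

/-- Exponent bookkeeping for the list size of `exists_codebook`. With `P = 2^(n(H-Ru))` and `Q =
2^(5nδ)` the left side is at most `1 + 4P · 9Q`; `64` is a convenient power of two above `37`. -/
lemma list_bound {n H Ru I IY δ N : ℝ} (hn : 0 ≤ n) (hδ : 0 ≤ δ) (hN0 : 0 < N)
    (hRuH : Ru ≤ H) (hRu : Ru + I ≤ IY) (hN : 2 ^ (n * (Ru + I + 3 * δ)) ≤ N)
    (hN2 : N ≤ 2 * 2 ^ (n * (Ru + I + 3 * δ))) :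
    1 + 2 * (2 : ℝ) ^ (-(n * (-H - 2 * δ))) / (N * (2 ^ (-(n * (I + δ))) / 2)) *
      (1 + 4 * N * 2 ^ (-(n * (IY - 2 * δ)))) ≤ 64 * 2 ^ (n * (H - Ru + 5 * δ)) := by
  have hA : 2 * (2 : ℝ) ^ (-(n * (-H - 2 * δ))) / (N * (2 ^ (-(n * (I + δ))) / 2)) ≤
      4 * 2 ^ (n * (H - Ru)) := by
    rw [div_le_iff₀ (by positivity)]
    have e : (2 : ℝ) ^ (-(n * (-H - 2 * δ))) =
        2 ^ (n * (H - Ru)) * (2 ^ (n * (Ru + I + 3 * δ)) * 2 ^ (-(n * (I + δ)))) := by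
      rw [← Real.rpow_add (by norm_num), ← Real.rpow_add (by norm_num)]
      congr 1; ring
    rw [e]
    have := mul_le_mul_of_nonneg_left (mul_le_mul_of_nonneg_right hN
      (show (0 : ℝ) ≤ 2 ^ (-(n * (I + δ))) by positivity))
      (show (0 : ℝ) ≤ 2 ^ (n * (H - Ru)) by positivity)
    linarith
  have hB : N * (2 : ℝ) ^ (-(n * (IY - 2 * δ))) ≤ 2 * 2 ^ (n * (5 * δ)) := by
    calc _ ≤ 2 * 2 ^ (n * (Ru + I + 3 * δ)) * (2 : ℝ) ^ (-(n * (IY - 2 * δ))) := by gcongr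
      _ = 2 * (2 : ℝ) ^ (n * (Ru + I + 3 * δ) + -(n * (IY - 2 * δ))) := by
          rw [mul_assoc, ← Real.rpow_add (by norm_num)]
      _ ≤ _ := by
          gcongr
          · norm_num
          · nlinarith
  have h1 : (1 : ℝ) ≤ 2 ^ (n * (5 * δ)) := Real.one_le_rpow (by norm_num) (by positivity)
  have h2 : (1 : ℝ) ≤ 2 ^ (n * (H - Ru)) :=
    Real.one_le_rpow (by norm_num) (mul_nonneg hn (by linarith))
  have e : (2 : ℝ) ^ (n * (H - Ru + 5 * δ)) = 2 ^ (n * (H - Ru)) * 2 ^ (n * (5 * δ)) := by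
    rw [← Real.rpow_add (by norm_num)]
    congr 1; ring
  rw [e]
  set P : ℝ := 2 ^ (n * (H - Ru))
  set Q : ℝ := 2 ^ (n * (5 * δ))
  have hC : 1 + 4 * N * (2 : ℝ) ^ (-(n * (IY - 2 * δ))) ≤ 9 * Q := by linarith
  have hC0 : 0 ≤ 1 + 4 * N * (2 : ℝ) ^ (-(n * (IY - 2 * δ))) := by positivity
  have := mul_le_mul hA hC hC0 (by positivity)
  have hPQ : 1 ≤ P * Q := one_le_mul_of_one_le_of_one_le h2 h1
  nlinarith

lemma half_le_two_rpow (x : ℝ) : x / 2 ≤ (2 : ℝ) ^ x := by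
  rcases le_or_gt x 0 with h | h
  · exact le_trans (by linarith) (Real.rpow_nonneg (by norm_num) x)
  · rw [Real.rpow_def_of_pos (by norm_num)]
    have h1 := Real.add_one_le_exp (Real.log 2 * x)
    have h2 := Real.log_two_gt_d9
    nlinarith

lemma sum_block_entropy {S : Type*} [Fintype S] {pS : S → ℝ} (hpS : pS ∈ stdSimplex ℝ S) (n : ℕ) :
    ∑ s : Fin n → S, prodW (fun _ => pS) s * Real.logb 2 (prodW (fun _ => pS) s) =
      n * ∑ s, pS s * Real.logb 2 (pS s) := by
  have e : ∀ s : Fin n → S, prodW (fun _ => pS) s * Real.logb 2 (prodW (fun _ => pS) s) =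
      ∑ i, prodW (fun _ => pS) s * Real.logb 2 (pS (s i)) := by
    intro s
    rw [← Finset.mul_sum]
    by_cases h : prodW (fun _ => pS) s = 0
    · simp [h]
    · congr 1
      rw [prodW, Real.logb_prod]
      intro i hi hz
      exact h (Finset.prod_eq_zero hi hz)
  simp only [e]
  rw [Finset.sum_comm]
  have e2 : ∀ i : Fin n, ∑ s : Fin n → S, prodW (fun _ => pS) s * Real.logb 2 (pS (s i)) =
      ∑ s, pS s * Real.logb 2 (pS s) := fun i =>
    sum_prodW_apply (fun _ => hpS.2) i fun x => Real.logb 2 (pS x)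
  simp only [e2]
  simp

variable {S U Y Z : Type*} [Fintype S] [Fintype U] [Fintype Y] [Fintype Z]
  {pS : S → ℝ} {κ : S → U → ℝ} {V : S → U → Y → ℝ} {V' : S → U → Z → ℝ}

/-- For long blocks there is a codebook for which the list of typical states is short, and for which
the selected codeword is typical with the state with large probability. -/
lemma exists_block_codebook (hpS : pS ∈ stdSimplex ℝ S) (hκ : ∀ s, κ s ∈ stdSimplex ℝ U)
    (hV : ∀ s u, V s u ∈ stdSimplex ℝ Y) {J : Type*} [Fintype J] {h : J → S → U → ℝ}
    {j₀ j₁ j₂ : J} (hj₀ : h j₀ = densUS pS κ) (hj₁ : h j₁ = condMean V (logPost pS κ V))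
    (hj₂ : h j₂ = condMean V fun _ => densUY pS κ V) {Ru : ℝ} (hRu0 : 0 ≤ Ru)
    (hRu1 : Ru + mean2 pS κ (densUS pS κ) ≤ mean2 pS κ (condMean V fun _ => densUY pS κ V))
    (hRu2 : Ru ≤ -mean2 pS κ (condMean V (logPost pS κ V))) {δ η : ℝ} (hδ : 0 < δ) (hη : 0 < η) :
    ∃ N₀ : ℕ, ∀ n : ℕ, N₀ ≤ n → ∃ (N : ℕ) (c : Fin N → Fin n → U) (F : (Fin n → S) → Fin N)
      (G : (Fin n → S) → Prop) (A : (Fin n → S) → (Fin n → Y) → Prop), 0 < N ∧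
      (N : ℝ) ≤ 2 * 2 ^ (n * (Ru + mean2 pS κ (densUS pS κ) + 3 * δ)) ∧
      (∀ s, G s → Typ pS κ h δ n s (c (F s))) ∧
      ∑ s, prodW (fun _ => pS) s * (if G s then 0 else 1) ≤ 4 * η ∧
      ∑ s, prodW (fun _ => pS) s * ∑ y, prodW (fun i => V (s i) (c (F s) i)) y *
        (if A s y then 0 else 1) ≤ 5 * η ∧
      ∑ s, prodW (fun _ => pS) s * ∑ y, prodW (fun i => V (s i) (c (F s) i)) y *
        ((if A s y then 1 else 0) * ∑ s', if A s' y then 1 else 0) ≤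
        64 * 2 ^ (n * (-mean2 pS κ (condMean V (logPost pS κ V)) - Ru + 5 * δ)) := by
  set I := mean2 pS κ (densUS pS κ) with hI
  set m₁ := mean2 pS κ (condMean V (logPost pS κ V)) with hm₁
  set IY := mean2 pS κ (condMean V fun _ => densUY pS κ V) with hIY
  have hI0 : 0 ≤ I := mean2_densUS_nonneg hpS hκ
  obtain ⟨N₁, hN₁⟩ := sum_not_typ_le hpS hκ h hδ (half_pos hη)
  obtain ⟨N₂, hN₂⟩ := sum_not_typ3_le hV hj₁ hj₂ hδ hη
  obtain ⟨N₃, hN₃⟩ := exists_nat_gt (8 / (η * δ))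
  refine ⟨max N₁ (max N₂ N₃), fun n hn => ?_⟩
  have hn1 : N₁ ≤ n := le_of_max_le_left hn
  have hn2 : N₂ ≤ n := le_of_max_le_left (le_of_max_le_right hn)
  have hn3 : (N₃ : ℝ) ≤ n := by exact_mod_cast le_of_max_le_right (le_of_max_le_right hn)
  have hn0 : (0 : ℝ) ≤ n := Nat.cast_nonneg n
  -- Of the surplus `3δ`, one `δ` offsets the loss in `le_hitMass`; the other `2δ` makes the
  -- expected number of typical codewords grow even when `Ru = 0`.
  set x : ℝ := 2 ^ (n * (Ru + I + 3 * δ)) with hx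
  have hx1 : 1 ≤ x := Real.one_le_rpow (by norm_num) (by positivity)
  set N : ℕ := ⌈x⌉₊ with hNd
  have hxN : x ≤ N := Nat.le_ceil x
  have hN0' : (0 : ℝ) < N := by linarith
  have hN0 : 0 < N := by exact_mod_cast hN0'
  have hN2x : (N : ℝ) ≤ 2 * x := by
    have := Nat.ceil_lt_add_one (show 0 ≤ x by linarith)
    linarith
  have hP := prodW_mem_stdSimplex (ι := Fin n) (v := fun _ => pS) fun _ => hpS
  have hκn : ∀ s : Fin n → S, prodW (fun i => κ (s i)) ∈ stdSimplex ℝ (Fin n → U) := fun s =>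
    prodW_mem_stdSimplex fun i => hκ _
  have hVn : ∀ (s : Fin n → S) (u : Fin n → U),
      prodW (fun i => V (s i) (u i)) ∈ stdSimplex ℝ (Fin n → Y) := fun s u =>
    prodW_mem_stdSimplex fun i => hV _ _
  -- The states to which `le_hitMass` applies; by Markov's inequality the others have probability at
  -- most `2 (η/2)`.
  set TS : (Fin n → S) → Prop := fun s => 1 / 2 ≤ ∑ u : Fin n → U, prodW (fun i => κ (s i)) u *
      (if Typ pS κ h δ n s u then 1 else 0) with hTSd
  have hTS : ∑ s, prodW (fun _ => pS) s * (if TS s then 0 else 1) ≤ η := by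
    have h1 := hN₁ n hn1
    have h2 : ∀ s, (if TS s then 0 else 1 : ℝ) ≤ 2 * ∑ u : Fin n → U,
        prodW (fun i => κ (s i)) u * (if Typ pS κ h δ n s u then 0 else 1) := by
      intro s
      have hnn : 0 ≤ ∑ u : Fin n → U,
          prodW (fun i => κ (s i)) u * (if Typ pS κ h δ n s u then 0 else 1) :=
        Finset.sum_nonneg fun u _ => mul_nonneg ((hκn s).1 u) (by split_ifs <;> norm_num)
      have hadd : ∑ u : Fin n → U, prodW (fun i => κ (s i)) u *
          (if Typ pS κ h δ n s u then 1 else 0) + ∑ u : Fin n → U,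
          prodW (fun i => κ (s i)) u * (if Typ pS κ h δ n s u then 0 else 1) = 1 := by
        rw [← Finset.sum_add_distrib]
        refine Eq.trans (Finset.sum_congr rfl fun u _ => ?_) (hκn s).2
        split_ifs <;> ring
      by_cases hs : TS s
      · simp only [hs, if_true]; linarith
      · have hlt := not_le.1 hs
        simp only [hs, if_false]; linarith
    calc _ ≤ ∑ s, prodW (fun _ => pS) s * (2 * ∑ u : Fin n → U,
          prodW (fun i => κ (s i)) u * (if Typ pS κ h δ n s u then 0 else 1)) :=
          Finset.sum_le_sum fun s _ => mul_le_mul_of_nonneg_left (h2 s) (hP.1 s)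
      _ = 2 * ∑ s, prodW (fun _ => pS) s * ∑ u : Fin n → U,
          prodW (fun i => κ (s i)) u * (if Typ pS κ h δ n s u then 0 else 1) := by
          rw [Finset.mul_sum]
          exact Finset.sum_congr rfl fun s _ => by ring
      _ ≤ η := by linarith
  have hNa : 4 / (N * ((2 : ℝ) ^ (-(n * (I + δ))) / 2)) ≤ η := by
    rw [div_le_iff₀ (by positivity)]
    have e1 : (2 : ℝ) ^ (n * (2 * δ)) ≤ N * 2 ^ (-(n * (I + δ))) := by
      calc _ ≤ x * (2 : ℝ) ^ (-(n * (I + δ))) := by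
            rw [hx, ← Real.rpow_add (by norm_num)]
            refine Real.rpow_le_rpow_of_exponent_le (by norm_num) ?_
            nlinarith
        _ ≤ _ := by gcongr
    have e2 := half_le_two_rpow (n * (2 * δ))
    rw [div_lt_iff₀ (by positivity)] at hN₃
    have e3 : (N₃ : ℝ) * (η * δ) ≤ n * (η * δ) := by gcongr
    have e4 := mul_le_mul_of_nonneg_left (e2.trans e1) hη.le
    linarith
  obtain ⟨c, F, G, hG, hbad, hlist⟩ := exists_codebook (T := Typ pS κ h δ n)
    (T3 := Typ3 pS κ V (m₁ - 2 * δ) (IY - 2 * δ) n) (T2 := Typ2 pS κ V (IY - 2 * δ) n)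
    (V := fun s u => prodW fun i => V (s i) (u i))
    hN0 (prodW_mem_stdSimplex (ι := Fin n) fun _ => margU_mem_stdSimplex hpS hκ)
    (a := (2 : ℝ) ^ (-(n * (I + δ))) / 2) (by positivity)
    (fun s (hs : TS s) => le_hitMass hpS hκ hj₀ hs) hP hVn
    (fun s u y h3 => h3.typ2 hpS hκ hV) hη hTS hNa
    (by positivity) (sum_typ3_le hpS hκ hV _ _ n)
    (by positivity) (sum_typ2_le hpS hκ hV _ n)
  -- The true state is missing from the list if it is not in `G` (at most `4η`) or if the output is
  -- atypical (at most `η`).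
  refine ⟨N, c, F, G, fun s y => G s ∧ Typ3 pS κ V (m₁ - 2 * δ) (IY - 2 * δ) n s (c (F s)) y,
    hN0, hN2x, hG, hbad, ?_, ?_⟩
  · have key : ∀ s, ∑ y, prodW (fun i => V (s i) (c (F s) i)) y * (if G s ∧
        Typ3 pS κ V (m₁ - 2 * δ) (IY - 2 * δ) n s (c (F s)) y then 0 else 1 : ℝ) ≤
        (if G s then 0 else 1) + η := by
      intro s
      by_cases hs : G s
      · simp only [hs, true_and, if_true, zero_add]
        exact hN₂ n hn2 s (c (F s)) (hG s hs)
      · simp only [hs, false_and, if_false, mul_one]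
        rw [(hVn s (c (F s))).2]
        linarith
    calc _ ≤ ∑ s, prodW (fun _ => pS) s * ((if G s then 0 else 1) + η) := by
          refine Finset.sum_le_sum fun s _ => mul_le_mul_of_nonneg_left ?_ (hP.1 s)
          refine le_trans (le_of_eq ?_) (key s)
          refine Finset.sum_congr rfl fun y _ => ?_
          congr
      _ ≤ 5 * η := by
          simp only [mul_add, Finset.sum_add_distrib, ← Finset.sum_mul, hP.2]
          linarith
  · refine le_trans ?_ (hlist.trans ?_)
    · refine Finset.sum_le_sum fun s _ => ?_
      rw [mul_assoc]
      refine mul_le_mul_of_nonneg_left ?_ (hP.1 s)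
      rw [Finset.sum_comm, Finset.mul_sum]
      refine Finset.sum_le_sum fun y _ => ?_
      rw [← Finset.mul_sum]
      refine le_trans (mul_le_mul_of_nonneg_left ?_ ((hVn s (c (F s))).1 y))
        (mul_left_comm _ _ _).le
      refine mul_le_mul ?_ (le_of_eq ?_) (Finset.sum_nonneg fun s _ => by split_ifs <;> norm_num)
        (ite_one_zero_nonneg _)
      · by_cases hs : G s
        · simp only [hs, if_true]
          exact ite_one_zero_le_one _
        · simp [hs]
      · refine Finset.sum_congr rfl fun s' _ => ?_
        congr
    · have := list_bound (H := -m₁) hn0 hδ.le hN0' hRu2 hRu1 hxN hN2x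
      simpa using this

/-- Existence of a block map `f` from state sequences to auxiliary sequences whose amplification
and leakage rates are those of the letter law. -/
theorem exists_block_map (hpS : pS ∈ stdSimplex ℝ S) (hκ : ∀ s, κ s ∈ stdSimplex ℝ U)
    (hV : ∀ s u, V s u ∈ stdSimplex ℝ Y) (hV' : ∀ s u, V' s u ∈ stdSimplex ℝ Z) {Ru : ℝ}
    (hRu0 : 0 ≤ Ru)
    (hRu1 : Ru + mean2 pS κ (densUS pS κ) ≤ mean2 pS κ (condMean V fun _ => densUY pS κ V))
    (hRu2 : Ru ≤ -mean2 pS κ (condMean V (logPost pS κ V)))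
    {R₁ : Z → ℝ} (hR₁ : ∀ z, 0 < R₁ z) (hR₁1 : ∑ z, R₁ z ≤ 1)
    {R₂ : U → Z → ℝ} (hR₂ : ∀ u z, 0 < R₂ u z) (hR₂1 : ∀ u, ∑ z, R₂ u z ≤ 1) {ε : ℝ}
    (hε : 0 < ε) : ∃ N₀ : ℕ, ∀ n : ℕ, N₀ ≤ n → ∃ f : (Fin n → S) → Fin n → U,
      n * (-∑ s, pS s * Real.logb 2 (pS s) + mean2 pS κ (condMean V (logPost pS κ V)) + Ru - ε) ≤
        (pairMI fun (s : Fin n → S) (y : Fin n → Y) =>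
          prodW (fun _ => pS) s * prodW (fun i => V (s i) (f s i)) y) ∧
      (pairMI fun (s : Fin n → S) (z : Fin n → Z) =>
          prodW (fun _ => pS) s * prodW (fun i => V' (s i) (f s i)) z) ≤
        n * (mean2 pS κ (condMean V' fun s u z => Real.logb 2 (V' s u z / R₁ z)) + ε) ∧
      (pairMI fun (s : Fin n → S) (z : Fin n → Z) =>
          prodW (fun _ => pS) s * prodW (fun i => V' (s i) (f s i)) z) ≤
        n * (Ru + mean2 pS κ (densUS pS κ) +
          mean2 pS κ (condMean V' fun s u z => Real.logb 2 (V' s u z / R₂ u z)) + ε) := by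
  set h₁ := condMean V' fun s u z => Real.logb 2 (V' s u z / R₁ z) with hh₁
  set h₂ := condMean V' fun s u z => Real.logb 2 (V' s u z / R₂ u z) with hh₂
  -- The first three functions serve the code, the last two the leakage bounds for the same code.
  set h : Fin 5 → S → U → ℝ := ![densUS pS κ, condMean V (logPost pS κ V),
    condMean V fun _ => densUY pS κ V, h₁, h₂] with hh
  have hne : Nonempty S := by
    by_contra hne
    rw [not_nonempty_iff] at hne
    simpa using hpS.2
  set C : ℝ := ∑ s, ∑ u, (|h₁ s u| + |h₂ s u|) with hC
  have hCle : ∀ s u, |h₁ s u| + |h₂ s u| ≤ C := fun s u =>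
    (Finset.single_le_sum (f := fun u => |h₁ s u| + |h₂ s u|) (fun u _ => by positivity)
      (Finset.mem_univ u)).trans
    (Finset.single_le_sum (f := fun s => ∑ u, (|h₁ s u| + |h₂ s u|))
      (fun s _ => Finset.sum_nonneg fun u _ => by positivity) (Finset.mem_univ s))
  have hC0 : 0 ≤ C := Finset.sum_nonneg fun s _ => Finset.sum_nonneg fun u _ => by positivity
  set l : ℝ := Real.logb 2 (Fintype.card S) with hl
  have hl0 : 0 ≤ l := Real.logb_nonneg (by norm_num) (by exact_mod_cast Fintype.card_pos)
  set δ := ε / 10 with hδd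
  have hδ : 0 < δ := by positivity
  -- Chosen so that the bad states' contribution `8Cη` to the leakage and the loss `5ηl` in
  -- amplification are each at most `ε/4`. The choice of `δ` makes the list exponent `5δ = ε/2`.
  set η := ε / (4 * (8 * C + 5 * l + 1)) with hηd
  have hη : 0 < η := by positivity
  have hηe : η * (8 * C + 5 * l + 1) = ε / 4 := by
    rw [hηd]; field_simp
  have hηC : 8 * C * η ≤ ε / 4 := by nlinarith [mul_nonneg hη.le hl0]
  have hηl : 5 * η * l ≤ ε / 4 := by nlinarith [mul_nonneg hη.le hC0]
  obtain ⟨N₁, hN₁⟩ := exists_block_codebook hpS hκ hV (h := h) (j₀ := 0) (j₁ := 1) (j₂ := 2)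
    rfl rfl rfl hRu0 hRu1 hRu2 hδ hη
  obtain ⟨N₂, hN₂⟩ := exists_nat_gt (36 / ε)
  refine ⟨max N₁ N₂, fun n hn => ?_⟩
  have hn2 : (N₂ : ℝ) ≤ n := by exact_mod_cast le_of_max_le_right hn
  rw [div_lt_iff₀ hε] at hN₂
  -- The additive constants `3 + log 64 = 9` then fit into the remaining `n ε / 4`.
  have hnε : 36 ≤ n * ε := by nlinarith
  have hn0 : (0 : ℝ) ≤ n := Nat.cast_nonneg n
  obtain ⟨N, c, F, G, A, hN0, hN2, hG, hbG, hbA, hlist⟩ := hN₁ n (le_of_max_le_left hn)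
  have hN0' : (0 : ℝ) < N := by exact_mod_cast hN0
  have hP := prodW_mem_stdSimplex (ι := Fin n) (v := fun _ => pS) fun _ => hpS
  refine ⟨fun s => c (F s), ?_, ?_, ?_⟩
  · have hK1 : (1 : ℝ) ≤
        64 * 2 ^ (n * (-mean2 pS κ (condMean V (logPost pS κ V)) - Ru + 5 * δ)) := by
      have : (1 : ℝ) ≤ 2 ^ (n * (-mean2 pS κ (condMean V (logPost pS κ V)) - Ru + 5 * δ)) :=
        Real.one_le_rpow (by norm_num) (mul_nonneg hn0 (by linarith))
      linarith
    have := le_pairMI_of_list hP (V := fun s => prodW fun i => V (s i) (c (F s) i))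
      (fun s => prodW_mem_stdSimplex fun i => hV _ _) A hK1 hbA hlist
    refine le_trans ?_ this
    rw [sum_block_entropy hpS, Real.logb_mul (by norm_num) (by positivity),
      Real.logb_rpow (by norm_num) (by norm_num)]
    have e1 : Real.logb 2 ((Fintype.card (Fin n → S) : ℕ) : ℝ) = n * l := by
      rw [Fintype.card_fun, Fintype.card_fin, Nat.cast_pow, Real.logb_pow]
    have e2 : Real.logb 2 64 = 6 := by
      rw [show (64 : ℝ) = 2 ^ (6 : ℕ) by norm_num, Real.logb_pow,
        Real.logb_self_eq_one (by norm_num)]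
      norm_num
    rw [e1, e2]
    have e3 := mul_le_mul_of_nonneg_left hηl hn0
    have e4 : n * (5 * δ) = n * ε / 2 := by rw [hδd]; ring
    linarith
  -- Reference law: the product of `R₁`, with `M = 1`.
  · have hb := pairMI_block_le hpS hV' (fun s => c (F s)) (R₀ := fun _ => R₁)
      (fun _ z => hR₁ z) (R := prodW fun _ => R₁) (fun z => Finset.prod_pos fun i _ => hR₁ _) (by
        rw [sum_prodW]
        exact Finset.prod_le_one (fun i _ => Finset.sum_nonneg fun z _ => (hR₁ z).le)
          fun i _ => hR₁1) one_pos (fun s z => by simp)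
    have ha := sum_additive_le hpS hκ (h := h) 3
      (fun s u => (le_add_of_nonneg_right (abs_nonneg _)).trans (hCle s u)) hδ.le hG hbG
    refine hb.trans ?_
    rw [Real.logb_one, zero_add]
    refine ha.trans ?_
    refine mul_le_mul_of_nonneg_left ?_ hn0
    change mean2 pS κ h₁ + δ + 2 * C * (4 * η) ≤ _
    linarith
  -- Reference law: the average over the codebook of the products of `R₂`; the selected codeword is
  -- one of `N` terms, so `M = N`.
  · have hb := pairMI_block_le hpS hV' (fun s => c (F s)) hR₂
      (R := fun z => (∑ k, prodW (fun i => R₂ (c k i)) z) / N)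
      (fun z => by
        refine div_pos (Finset.sum_pos (fun k _ => Finset.prod_pos fun i _ => hR₂ _ _) ?_) hN0'
        exact ⟨⟨0, hN0⟩, Finset.mem_univ _⟩) (by
        rw [← Finset.sum_div, div_le_one hN0', Finset.sum_comm]
        calc _ ≤ ∑ _k : Fin N, (1 : ℝ) := by
              refine Finset.sum_le_sum fun k _ => ?_
              rw [sum_prodW]
              exact Finset.prod_le_one (fun i _ => Finset.sum_nonneg fun z _ => (hR₂ _ z).le)
                fun i _ => hR₂1 _
          _ = N := by simp) hN0' (fun s z => by
        rw [mul_div_cancel₀ _ hN0'.ne']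
        exact Finset.single_le_sum (f := fun k => prodW (fun i => R₂ (c k i)) z)
          (fun k _ => prodW_nonneg (fun i z => (hR₂ _ z).le) z) (Finset.mem_univ (F s)))
    have ha := sum_additive_le hpS hκ (h := h) 4
      (fun s u => (le_add_of_nonneg_left (abs_nonneg _)).trans (hCle s u)) hδ.le hG hbG
    refine hb.trans ((add_le_add_right ha _).trans ?_)
    have hlN : Real.logb 2 N ≤ 1 + n * (Ru + mean2 pS κ (densUS pS κ) + 3 * δ) := by
      refine (Real.logb_le_logb_of_le (by norm_num) hN0' hN2).trans_eq ?_
      rw [Real.logb_mul (by norm_num) (by positivity), Real.logb_rpow (by norm_num) (by norm_num),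
        Real.logb_self_eq_one (by norm_num)]
    change _ + n * (mean2 pS κ h₂ + δ + 2 * C * (4 * η)) ≤ _
    have e3 := mul_le_mul_of_nonneg_left hηC hn0
    have e4 : n * δ = n * ε / 10 := by rw [hδd]; ring
    linarith

end blocks

/-! ### Information quantities of the letter law -/

section letterInfo

variable {S U Y : Type*} [Fintype S] [Fintype U] [Fintype Y] {pS : S → ℝ} {κ : S → U → ℝ}
  {V : S → U → Y → ℝ}

lemma mean2_condMean (pS : S → ℝ) (κ : S → U → ℝ) (V : S → U → Y → ℝ) (g : S → U → Y → ℝ) :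
    mean2 pS κ (condMean V g) = ∑ s, ∑ u, ∑ y, pS s * κ s u * V s u y * g s u y := by
  simp only [mean2, condMean, Finset.mul_sum, mul_assoc]

lemma pairMI_US (hκ : ∀ s, κ s ∈ stdSimplex ℝ U) :
    (pairMI fun u s => pS s * κ s u) = mean2 pS κ (densUS pS κ) := by
  simp only [pairMI, mean2, densUS]
  rw [Finset.sum_comm]
  refine Finset.sum_congr rfl fun s _ => Finset.sum_congr rfl fun u _ => ?_
  rw [← Finset.mul_sum, (hκ s).2, mul_one, mul_comm (∑ b', _) (pS s)]
  by_cases h : pS s = 0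
  · simp [h]
  · rw [mul_div_mul_left _ _ h]
    rfl

lemma pairMI_UY (hV : ∀ s u, V s u ∈ stdSimplex ℝ Y) :
    pairMI (margUY pS κ V) = mean2 pS κ (condMean V fun _ => densUY pS κ V) := by
  simp only [pairMI, mean2_condMean, sum_margUY hV]
  conv_rhs => rw [Finset.sum_comm]
  refine Finset.sum_congr rfl fun u _ => ?_
  conv_rhs => rw [Finset.sum_comm]
  refine Finset.sum_congr rfl fun y _ => ?_
  rw [← Finset.sum_mul]
  rfl

/-- The form `H(S) - H(S|Y,U)`, which matches the amplification bound. -/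
lemma pairMI_S_YU (hpS : pS ∈ stdSimplex ℝ S) (hκ : ∀ s, κ s ∈ stdSimplex ℝ U)
    (hV : ∀ s u, V s u ∈ stdSimplex ℝ Y) :
    (pairMI fun s (a : Y × U) => pS s * κ s a.2 * V s a.2 a.1) =
      -∑ s, pS s * Real.logb 2 (pS s) + mean2 pS κ (condMean V (logPost pS κ V)) := by
  have hrow : ∀ s, ∑ a : Y × U, pS s * κ s a.2 * V s a.2 a.1 = pS s := fun s => by
    rw [Fintype.sum_prod_type, Finset.sum_comm]
    simp only [← Finset.mul_sum, (hV _ _).2, mul_one, (hκ s).2]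
  have e : ∀ s, pS s * Real.logb 2 (pS s) =
      ∑ u, ∑ y, pS s * κ s u * V s u y * Real.logb 2 (pS s) := fun s => by
    simp only [← Finset.sum_mul, ← Finset.mul_sum, (hV _ _).2, mul_one, (hκ s).2]
  simp only [pairMI, mean2_condMean, hrow, e]
  rw [neg_add_eq_sub, ← Finset.sum_sub_distrib]
  refine Finset.sum_congr rfl fun s _ => ?_
  rw [Fintype.sum_prod_type, Finset.sum_comm, ← Finset.sum_sub_distrib]
  refine Finset.sum_congr rfl fun u _ => ?_
  rw [← Finset.sum_sub_distrib]
  refine Finset.sum_congr rfl fun y _ => ?_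
  change pS s * κ s u * V s u y * Real.logb 2 (pS s * κ s u * V s u y /
    (pS s * margUY pS κ V u y)) = _
  rcases (joint_nonneg hpS hκ hV s u y).eq_or_lt with h0 | h0
  · rw [← h0]; simp
  · have hm := h0.trans_le (joint_le_margUY hpS hκ hV s u y)
    have hp : pS s ≠ 0 := fun hz => h0.ne' (by rw [hz]; ring)
    rw [logPost, Real.logb_div h0.ne' (mul_ne_zero hp hm.ne'), Real.logb_mul hp hm.ne',
      Real.logb_div h0.ne' hm.ne']
    ring

lemma pairMI_US_Y (hV : ∀ s u, V s u ∈ stdSimplex ℝ Y) :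
    (pairMI fun (a : U × S) y => pS a.2 * κ a.2 a.1 * V a.2 a.1 y) =
      mean2 pS κ (condMean V fun s u y => Real.logb 2 (V s u y / margY pS κ V y)) := by
  simp only [pairMI, mean2_condMean]
  rw [Fintype.sum_prod_type, Finset.sum_comm]
  refine Finset.sum_congr rfl fun s _ => Finset.sum_congr rfl fun u _ =>
    Finset.sum_congr rfl fun y _ => ?_
  have e : ∑ a : U × S, pS a.2 * κ a.2 a.1 * V a.2 a.1 y = margY pS κ V y := by
    rw [Fintype.sum_prod_type]
    rfl
  rw [e, ← Finset.mul_sum, (hV s u).2, mul_one]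
  by_cases h : pS s * κ s u = 0
  · simp only [h, zero_mul]
  · rw [mul_div_mul_left _ _ h]

/-- The chain rule `I(U;S) + I(S;Y|U)`, which matches the leakage bound through the codebook. -/
lemma pairMI_S_YU' (hpS : pS ∈ stdSimplex ℝ S) (hκ : ∀ s, κ s ∈ stdSimplex ℝ U)
    (hV : ∀ s u, V s u ∈ stdSimplex ℝ Y) :
    (pairMI fun s (a : Y × U) => pS s * κ s a.2 * V s a.2 a.1) = mean2 pS κ (densUS pS κ) +
      mean2 pS κ (condMean V fun s u y =>
        Real.logb 2 (V s u y / (margUY pS κ V u y / margU pS κ u))) := by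
  have hrow : ∀ s, ∑ a : Y × U, pS s * κ s a.2 * V s a.2 a.1 = pS s := fun s => by
    rw [Fintype.sum_prod_type, Finset.sum_comm]
    simp only [← Finset.mul_sum, (hV _ _).2, mul_one, (hκ s).2]
  have e : ∀ s u, pS s * κ s u * densUS pS κ s u =
      ∑ y, pS s * κ s u * V s u y * densUS pS κ s u := fun s u => by
    simp only [← Finset.sum_mul, ← Finset.mul_sum, (hV _ _).2, mul_one]
  rw [mean2_condMean]
  simp only [pairMI, mean2, hrow, e]
  rw [← Finset.sum_add_distrib]
  refine Finset.sum_congr rfl fun s _ => ?_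
  rw [Fintype.sum_prod_type, Finset.sum_comm, ← Finset.sum_add_distrib]
  refine Finset.sum_congr rfl fun u _ => ?_
  rw [← Finset.sum_add_distrib]
  refine Finset.sum_congr rfl fun y _ => ?_
  change pS s * κ s u * V s u y * Real.logb 2 (pS s * κ s u * V s u y /
    (pS s * margUY pS κ V u y)) = _
  rcases (joint_nonneg hpS hκ hV s u y).eq_or_lt with h0 | h0
  · rw [← h0]; simp
  · have hm := h0.trans_le (joint_le_margUY hpS hκ hV s u y)
    have hp : pS s ≠ 0 := fun hz => h0.ne' (by rw [hz]; ring)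
    have hk : κ s u ≠ 0 := fun hz => h0.ne' (by rw [hz]; ring)
    have hv : V s u y ≠ 0 := fun hz => h0.ne' (by rw [hz]; ring)
    have hu : margU pS κ u ≠ 0 := by
      refine (lt_of_lt_of_le ?_ (mul_le_margU hpS hκ s u)).ne'
      exact lt_of_le_of_ne (mul_nonneg (hpS.1 s) ((hκ s).1 u)) (mul_ne_zero hp hk).symm
    rw [densUS, Real.logb_div h0.ne' (mul_ne_zero hp hm.ne'), Real.logb_mul hp hm.ne',
      Real.logb_mul (mul_ne_zero hp hk) hv, Real.logb_mul hp hk, Real.logb_div hk hu,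
      Real.logb_div hv (div_ne_zero hm.ne' hu), Real.logb_div hm.ne' hu]
    ring

end letterInfo

/-! ### The channel induced by the auxiliary variable -/

section induced

variable {S X Y Z U : Type*} [Fintype X]

/-- The conditional law of `U` given `S`. -/
def kernU (q : S → U × X → ℝ) (s : S) (u : U) : ℝ := ∑ x, q s (u, x)

/-- A version of the conditional law of `X` given `(S, U)`. -/
def kernX [Fintype U] (q : S → U × X → ℝ) (s : S) (u : U) (x : X) : ℝ :=
  -- On null pairs the law of `X` given `S` fills in: the encoder may meet such pairs on bad states
  -- and still needs a probability vector.
  if kernU q s u = 0 then ∑ u', q s (u', x) else q s (u, x) / kernU q s u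

/-- The channel from `(S, U)` obtained from a channel `w` from `(X, S)`. -/
def inducedChannel [Fintype U] (q : S → U × X → ℝ) (w : X → S → Y → ℝ) (s : S) (u : U) (y : Y) :
    ℝ := ∑ x, kernX q s u x * w x s y

variable [Fintype U] {q : S → U × X → ℝ}

lemma kernU_mem_stdSimplex (hq : ∀ s, q s ∈ stdSimplex ℝ (U × X)) (s : S) :
    kernU q s ∈ stdSimplex ℝ U := by
  refine ⟨fun u => Finset.sum_nonneg fun x _ => (hq s).1 _, ?_⟩
  have := (hq s).2
  rwa [Fintype.sum_prod_type] at this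

lemma kernX_mem_stdSimplex (hq : ∀ s, q s ∈ stdSimplex ℝ (U × X)) (s : S) (u : U) :
    kernX q s u ∈ stdSimplex ℝ X := by
  by_cases h : kernU q s u = 0
  · refine ⟨fun x => ?_, ?_⟩
    · simp only [kernX, h, if_true]
      exact Finset.sum_nonneg fun u' _ => (hq s).1 _
    · simp only [kernX, h, if_true]
      rw [Finset.sum_comm]
      exact (kernU_mem_stdSimplex hq s).2
  · refine ⟨fun x => ?_, ?_⟩
    · simp only [kernX, h, if_false]
      exact div_nonneg ((hq s).1 _) ((kernU_mem_stdSimplex hq s).1 u)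
    · simp only [kernX, h, if_false, ← Finset.sum_div]
      exact div_self h

lemma kernU_mul_kernX (hq : ∀ s, q s ∈ stdSimplex ℝ (U × X)) (s : S) (u : U) (x : X) :
    kernU q s u * kernX q s u x = q s (u, x) := by
  by_cases h : kernU q s u = 0
  · rw [h, zero_mul]
    exact ((Finset.sum_eq_zero_iff_of_nonneg fun x _ => (hq s).1 (u, x)).1 h x
      (Finset.mem_univ x)).symm
  · simp only [kernX, h, if_false]
    field_simp

lemma inducedChannel_mem_stdSimplex [Fintype Y] (hq : ∀ s, q s ∈ stdSimplex ℝ (U × X))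
    {w : X → S → Y → ℝ} (hw : ∀ x s, w x s ∈ stdSimplex ℝ Y) (s : S) (u : U) :
    inducedChannel q w s u ∈ stdSimplex ℝ Y := by
  have hk := kernX_mem_stdSimplex hq s u
  refine ⟨fun y => Finset.sum_nonneg fun x _ => mul_nonneg (hk.1 x) ((hw x s).1 y), ?_⟩
  simp only [inducedChannel]
  rw [Finset.sum_comm]
  simp only [← Finset.mul_sum, (hw _ _).2, mul_one, hk.2]

/-- The first output marginal of a channel with two outputs. -/
def chanFst [Fintype Z] (W : X → S → Y × Z → ℝ) (x : X) (s : S) (y : Y) : ℝ := ∑ z, W x s (y, z)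

/-- The second output marginal of a channel with two outputs. -/
def chanSnd [Fintype Y] (W : X → S → Y × Z → ℝ) (x : X) (s : S) (z : Z) : ℝ := ∑ y, W x s (y, z)

end induced

section channelMarginals

variable {S X Y Z : Type*} [Fintype Y] [Fintype Z] {W : X → S → Y × Z → ℝ}

lemma chanFst_mem_stdSimplex (hW : ∀ x s, W x s ∈ stdSimplex ℝ (Y × Z)) (x : X) (s : S) :
    chanFst W x s ∈ stdSimplex ℝ Y := by
  refine ⟨fun y => Finset.sum_nonneg fun z _ => (hW x s).1 _, ?_⟩
  have := (hW x s).2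
  rwa [Fintype.sum_prod_type] at this

lemma chanSnd_mem_stdSimplex (hW : ∀ x s, W x s ∈ stdSimplex ℝ (Y × Z)) (x : X) (s : S) :
    chanSnd W x s ∈ stdSimplex ℝ Z := by
  refine ⟨fun y => Finset.sum_nonneg fun z _ => (hW x s).1 _, ?_⟩
  have := (hW x s).2
  rwa [Fintype.sum_prod_type_right] at this

end channelMarginals

/-! ### Laws -/

section laws

lemma law_congr {Ω α β : Type*} [Fintype Ω] (p : Ω → ℝ) {A : Ω → α} {B : Ω → β} {a : α} {b : β}
    (h : ∀ ω, A ω = a ↔ B ω = b) : law p A a = law p B b := by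
  simp only [law]
  refine Finset.sum_congr rfl fun ω _ => ?_
  simp only [h ω]

variable {S X Y Z U : Type*} [Fintype S] [Fintype X] [Fintype Y] [Fintype Z] [Fintype U]
  {pS : S → ℝ} {W : X → S → Y × Z → ℝ} {q : S → U × X → ℝ}

lemma law_letter_S_YU (hq : ∀ s, q s ∈ stdSimplex ℝ (U × X)) (a : S × Y × U) :
    law (letterLaw pS W q) (fun ω => (ω.2.1, ω.2.2.2.1, ω.1)) a =
      pS a.1 * kernU q a.1 a.2.2 * inducedChannel q (chanFst W) a.1 a.2.2 a.2.1 := by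
  obtain ⟨s, y, u⟩ := a
  simp only [law, Fintype.sum_prod_type, letterLaw, Prod.mk.injEq]
  rw [Finset.sum_eq_single u (fun u' _ h => by simp [h]) (by simp),
    Finset.sum_eq_single s (fun s' _ h => by simp [h]) (by simp)]
  simp only [inducedChannel, Finset.mul_sum]
  refine Finset.sum_congr rfl fun x _ => ?_
  rw [Finset.sum_eq_single y (fun y' _ h => by simp [h]) (by simp)]
  simp only [and_self, if_true]
  rw [← Finset.mul_sum, ← kernU_mul_kernX hq, chanFst]
  ring

lemma law_letter_S_ZU (hq : ∀ s, q s ∈ stdSimplex ℝ (U × X)) (a : S × Z × U) :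
    law (letterLaw pS W q) (fun ω => (ω.2.1, ω.2.2.2.2, ω.1)) a =
      pS a.1 * kernU q a.1 a.2.2 * inducedChannel q (chanSnd W) a.1 a.2.2 a.2.1 := by
  obtain ⟨s, z, u⟩ := a
  simp only [law, Fintype.sum_prod_type, letterLaw, Prod.mk.injEq]
  rw [Finset.sum_eq_single u (fun u' _ h => by simp [h]) (by simp),
    Finset.sum_eq_single s (fun s' _ h => by simp [h]) (by simp)]
  simp only [inducedChannel, Finset.mul_sum]
  refine Finset.sum_congr rfl fun x _ => ?_
  rw [Finset.sum_comm, Finset.sum_eq_single z (fun z' _ h => by simp [h]) (by simp)]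
  simp only [and_self, if_true]
  rw [← Finset.mul_sum, ← kernU_mul_kernX hq, chanSnd]
  ring

lemma law_letter_YU (hq : ∀ s, q s ∈ stdSimplex ℝ (U × X)) (a : Y × U) :
    law (letterLaw pS W q) (fun ω => (ω.2.2.2.1, ω.1)) a =
      margUY pS (kernU q) (inducedChannel q (chanFst W)) a.2 a.1 := by
  rw [law_snd (letterLaw pS W q) (fun ω => ω.2.1) (fun ω => (ω.2.2.2.1, ω.1))]
  simp only [law_letter_S_YU hq]
  rfl

lemma law_letter_US (hq : ∀ s, q s ∈ stdSimplex ℝ (U × X))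
    (hW : ∀ x s, W x s ∈ stdSimplex ℝ (Y × Z)) (u : U) (s : S) :
    law (letterLaw pS W q) (fun ω => (ω.1, ω.2.1)) (u, s) = pS s * kernU q s u := by
  rw [law_fst (letterLaw pS W q) (fun ω => (ω.1, ω.2.1)) (fun ω => ω.2.2.2.1)]
  have : ∀ y, law (letterLaw pS W q) (fun ω => ((ω.1, ω.2.1), ω.2.2.2.1)) ((u, s), y) =
      pS s * kernU q s u * inducedChannel q (chanFst W) s u y := fun y => by
    rw [← law_letter_S_YU hq (s, y, u)]
    refine law_congr _ fun ω => ?_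
    simp only [Prod.mk.injEq]
    tauto
  simp only [this, ← Finset.mul_sum,
    (inducedChannel_mem_stdSimplex hq (chanFst_mem_stdSimplex hW) s u).2, mul_one]

lemma letter_mutualInfo_US (hq : ∀ s, q s ∈ stdSimplex ℝ (U × X))
    (hW : ∀ x s, W x s ∈ stdSimplex ℝ (Y × Z)) :
    mutualInfo (letterLaw pS W q) (fun ω => ω.1) (fun ω => ω.2.1) =
      mean2 pS (kernU q) (densUS pS (kernU q)) := by
  rw [mutualInfo_eq_pairMI, ← pairMI_US (kernU_mem_stdSimplex hq)]
  simp only [law_letter_US hq hW]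

lemma letter_mutualInfo_UY (hq : ∀ s, q s ∈ stdSimplex ℝ (U × X))
    (hW : ∀ x s, W x s ∈ stdSimplex ℝ (Y × Z)) :
    mutualInfo (letterLaw pS W q) (fun ω => ω.1) (fun ω => ω.2.2.2.1) =
      mean2 pS (kernU q) (condMean (inducedChannel q (chanFst W)) fun _ =>
        densUY pS (kernU q) (inducedChannel q (chanFst W))) := by
  rw [mutualInfo_eq_pairMI,
    ← pairMI_UY (inducedChannel_mem_stdSimplex hq (chanFst_mem_stdSimplex hW))]
  congr 1
  funext u y
  rw [← law_letter_YU hq (y, u)]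
  refine law_congr _ fun ω => ?_
  simp only [Prod.mk.injEq]
  tauto

lemma letter_condEntropy (hq : ∀ s, q s ∈ stdSimplex ℝ (U × X)) :
    condEntropy (letterLaw pS W q) (fun ω => ω.2.1) (fun ω => (ω.2.2.2.1, ω.1)) =
      -mean2 pS (kernU q) (condMean (inducedChannel q (chanFst W))
        (logPost pS (kernU q) (inducedChannel q (chanFst W)))) := by
  simp only [condEntropy, law_letter_S_YU hq, law_letter_YU hq, mean2_condMean]
  congr 1
  refine Finset.sum_congr rfl fun s _ => ?_
  rw [Fintype.sum_prod_type, Finset.sum_comm]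
  refine Finset.sum_congr rfl fun u _ => Finset.sum_congr rfl fun y _ => ?_
  rfl

lemma letter_mutualInfo_S_YU (hpS : pS ∈ stdSimplex ℝ S) (hq : ∀ s, q s ∈ stdSimplex ℝ (U × X))
    (hW : ∀ x s, W x s ∈ stdSimplex ℝ (Y × Z)) :
    mutualInfo (letterLaw pS W q) (fun ω => ω.2.1) (fun ω => (ω.2.2.2.1, ω.1)) =
      -∑ s, pS s * Real.logb 2 (pS s) + mean2 pS (kernU q) (condMean (inducedChannel q (chanFst W))
        (logPost pS (kernU q) (inducedChannel q (chanFst W)))) := by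
  rw [mutualInfo_eq_pairMI, ← pairMI_S_YU hpS (kernU_mem_stdSimplex hq)
    (inducedChannel_mem_stdSimplex hq (chanFst_mem_stdSimplex hW))]
  simp only [law_letter_S_YU hq]

lemma letter_mutualInfo_S_ZU (hpS : pS ∈ stdSimplex ℝ S) (hq : ∀ s, q s ∈ stdSimplex ℝ (U × X))
    (hW : ∀ x s, W x s ∈ stdSimplex ℝ (Y × Z)) :
    mutualInfo (letterLaw pS W q) (fun ω => ω.2.1) (fun ω => (ω.2.2.2.2, ω.1)) =
      mean2 pS (kernU q) (densUS pS (kernU q)) +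
      mean2 pS (kernU q) (condMean (inducedChannel q (chanSnd W)) fun s u z =>
        Real.logb 2 (inducedChannel q (chanSnd W) s u z /
          (margUY pS (kernU q) (inducedChannel q (chanSnd W)) u z / margU pS (kernU q) u))) := by
  rw [mutualInfo_eq_pairMI, ← pairMI_S_YU' hpS (kernU_mem_stdSimplex hq)
    (inducedChannel_mem_stdSimplex hq (chanSnd_mem_stdSimplex hW))]
  simp only [law_letter_S_ZU hq]

lemma letter_mutualInfo_US_Z (hq : ∀ s, q s ∈ stdSimplex ℝ (U × X))
    (hW : ∀ x s, W x s ∈ stdSimplex ℝ (Y × Z)) :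
    mutualInfo (letterLaw pS W q) (fun ω => (ω.1, ω.2.1)) (fun ω => ω.2.2.2.2) =
      mean2 pS (kernU q) (condMean (inducedChannel q (chanSnd W)) fun s u z =>
        Real.logb 2 (inducedChannel q (chanSnd W) s u z /
          margY pS (kernU q) (inducedChannel q (chanSnd W)) z)) := by
  rw [mutualInfo_eq_pairMI, ← pairMI_US_Y
    (inducedChannel_mem_stdSimplex hq (chanSnd_mem_stdSimplex hW))]
  congr 1
  funext a z
  rw [← law_letter_S_ZU hq (a.2, z, a.1)]
  refine law_congr _ fun ω => ?_
  obtain ⟨u, s⟩ := a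
  simp only [Prod.mk.injEq]
  tauto

/-! ### Block laws under the letterwise encoder -/

/-- The encoder that draws the input letters independently given the state and the auxiliary
sequence `f s`. -/
def blockEncoder {n : ℕ} (q : S → U × X → ℝ) (f : (Fin n → S) → Fin n → U) (s : Fin n → S)
    (x : Fin n → X) : ℝ := prodW (fun i => kernX q (s i) (f s i)) x

lemma law_block_fst (n : ℕ) (f : (Fin n → S) → Fin n → U) (s : Fin n → S) (y : Fin n → Y) :
    law (blockLaw pS W n (blockEncoder q f)) (fun ω => (ω.1, ω.2.2.1)) (s, y) =
      prodW (fun _ => pS) s *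
        prodW (fun i => inducedChannel q (chanFst W) (s i) (f s i)) y := by
  simp only [law, Fintype.sum_prod_type, blockLaw, Prod.mk.injEq]
  rw [Finset.sum_eq_single s (fun s' _ h => by simp [h]) (by simp)]
  have h1 : ∀ x : Fin n → X, ∑ y' : Fin n → Y, ∑ z : Fin n → Z, (if s = s ∧ y' = y then
      (∏ i, pS (s i)) * blockEncoder q f s x * ∏ i, W (x i) (s i) (y' i, z i) else 0) =
      (∏ i, pS (s i)) * (prodW (fun i => kernX q (s i) (f s i)) x *
        ∏ i, chanFst W (x i) (s i) (y i)) := by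
    intro x
    rw [Finset.sum_eq_single y (fun y' _ h => by simp [h]) (by simp)]
    simp only [and_self, if_true]
    rw [← Finset.mul_sum, mul_assoc]
    congr 2
    exact sum_prodW fun i z => W (x i) (s i) (y i, z)
  refine (Finset.sum_congr rfl fun x _ => h1 x).trans ?_
  rw [← Finset.mul_sum, sum_prodW_mul_prod (fun i => kernX q (s i) (f s i))
    fun i x => chanFst W x (s i) (y i)]
  rfl

lemma law_block_snd (n : ℕ) (f : (Fin n → S) → Fin n → U) (s : Fin n → S) (z : Fin n → Z) :
    law (blockLaw pS W n (blockEncoder q f)) (fun ω => (ω.1, ω.2.2.2)) (s, z) =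
      prodW (fun _ => pS) s *
        prodW (fun i => inducedChannel q (chanSnd W) (s i) (f s i)) z := by
  simp only [law, Fintype.sum_prod_type, blockLaw, Prod.mk.injEq]
  rw [Finset.sum_eq_single s (fun s' _ h => by simp [h]) (by simp)]
  have h1 : ∀ x : Fin n → X, ∑ y : Fin n → Y, ∑ z' : Fin n → Z, (if s = s ∧ z' = z then
      (∏ i, pS (s i)) * blockEncoder q f s x * ∏ i, W (x i) (s i) (y i, z' i) else 0) =
      (∏ i, pS (s i)) * (prodW (fun i => kernX q (s i) (f s i)) x *
        ∏ i, chanSnd W (x i) (s i) (z i)) := by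
    intro x
    rw [Finset.sum_comm, Finset.sum_eq_single z (fun z' _ h => by simp [h]) (by simp)]
    simp only [and_self, if_true]
    rw [← Finset.mul_sum, mul_assoc]
    congr 2
    exact sum_prodW fun i y => W (x i) (s i) (y, z i)
  refine (Finset.sum_congr rfl fun x _ => h1 x).trans ?_
  rw [← Finset.mul_sum, sum_prodW_mul_prod (fun i => kernX q (s i) (f s i))
    fun i x => chanSnd W x (s i) (z i)]
  rfl

/-! ### Achievability -/

lemma mul_mean_div {n a M : ℝ} (hn : 0 < n) (h : n * a ≤ M) : a ≤ 1 / n * M := by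
  rw [one_div, inv_mul_eq_div, le_div_iff₀ hn]
  linarith

lemma mean_div_le {n a M : ℝ} (hn : 0 < n) (h : M ≤ n * a) : 1 / n * M ≤ a := by
  rw [one_div, inv_mul_eq_div, div_le_iff₀ hn]
  linarith

theorem achievable_of_mem_ratePairs (hpS : pS ∈ stdSimplex ℝ S)
    (hW : ∀ x s, W x s ∈ stdSimplex ℝ (Y × Z)) (hq : ∀ s, q s ∈ stdSimplex ℝ (U × X))
    {R : ℝ × ℝ} (hR : R ∈ ratePairs pS W q) : Achievable pS W R.1 R.2 := by
  obtain ⟨-, Ru, hRu0, hRu, hRa, hRl⟩ := hR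
  rw [letter_mutualInfo_US hq hW, letter_mutualInfo_UY hq hW, letter_condEntropy hq] at hRu
  rw [letter_mutualInfo_S_YU hpS hq hW] at hRa
  rw [letter_mutualInfo_S_ZU hpS hq hW, letter_mutualInfo_US_Z hq hW] at hRl
  have hκ := kernU_mem_stdSimplex hq
  have hV := inducedChannel_mem_stdSimplex hq (chanFst_mem_stdSimplex hW)
  have hV' := inducedChannel_mem_stdSimplex hq (chanSnd_mem_stdSimplex hW)
  set κ := kernU q
  set V := inducedChannel q (chanFst W)
  set V' := inducedChannel q (chanSnd W)
  have hRu1 := (le_min_iff.1 hRu).1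
  have hRu2 := (le_min_iff.1 hRu).2
  have hZ : Nonempty Z := by
    by_contra hZ
    rw [not_nonempty_iff] at hZ
    have hS : Nonempty S := by
      by_contra hS
      rw [not_nonempty_iff] at hS
      simpa using hpS.2
    obtain ⟨s⟩ := hS
    have hU : Nonempty U := by
      by_contra hU
      rw [not_nonempty_iff] at hU
      simpa using (hκ s).2
    obtain ⟨u⟩ := hU
    simpa using (hV' s u).2
  intro ε hε
  -- Mixing weight of the uniform law: the smoothing cost `-log (1 - t)` equals `ε/2`. Smoothing is
  -- needed because untypical states may produce outputs of zero reference probability.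
  set t : ℝ := 1 - 2 ^ (-(ε / 2)) with ht
  have h1t : 1 - t = 2 ^ (-(ε / 2)) := by rw [ht]; ring
  have h1t0 : 0 < 1 - t := by rw [h1t]; positivity
  have ht1 : t < 1 := by linarith
  have ht0 : 0 < t := by
    have : (2 : ℝ) ^ (-(ε / 2)) < 1 := Real.rpow_lt_one_of_one_lt_of_neg (by norm_num) (by linarith)
    rw [ht]; linarith
  have hlog : Real.logb 2 (1 - t) = -(ε / 2) := by
    rw [h1t, Real.logb_rpow (by norm_num) (by norm_num)]
  have hc : (0 : ℝ) < Fintype.card Z := by exact_mod_cast Fintype.card_pos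
  set m : ℝ := t / Fintype.card Z with hm
  have hm0 : 0 < m := by positivity
  have hmsum : ∑ _z : Z, m = t := by
    simp only [Finset.sum_const, Finset.card_univ, nsmul_eq_mul, hm]
    field_simp
  have hmU0 : ∀ u, 0 ≤ margU pS κ u := (margU_mem_stdSimplex hpS hκ).1
  have hmUZ0 : ∀ u z, 0 ≤ margUY pS κ V' u z := margUY_nonneg hpS hκ hV'
  have hmZ0 : ∀ z, 0 ≤ margY pS κ V' z := fun z => Finset.sum_nonneg fun u _ => hmUZ0 u z
  have hs₁ := mean2_smoothed_le hpS hκ hV' (R := fun _ => margY pS κ V')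
    (fun s u z h0 => h0.trans_le ((joint_le_margUY hpS hκ hV' s u z).trans
      (margUY_le_margY hpS hκ hV' u z))) ht1 hm0.le
  have hs₂ := mean2_smoothed_le hpS hκ hV' (R := fun u z => margUY pS κ V' u z / margU pS κ u)
    (fun s u z h0 => by
      have h2 : 0 < pS s * κ s u := pos_of_mul_pos_left h0 ((hV' s u).1 z)
      exact div_pos (h0.trans_le (joint_le_margUY hpS hκ hV' s u z))
        (h2.trans_le (mul_le_margU hpS hκ s u))) ht1 hm0.le
  obtain ⟨N₀, hN₀⟩ := exists_block_map hpS hκ hV hV' hRu0 (by linarith) hRu2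
    (R₁ := fun z => (1 - t) * margY pS κ V' z + m)
    (fun z => by have := hmZ0 z; positivity)
    (by
      rw [Finset.sum_add_distrib, ← Finset.mul_sum, sum_margY hpS hκ hV', hmsum]
      linarith)
    (R₂ := fun u z => (1 - t) * (margUY pS κ V' u z / margU pS κ u) + m)
    (fun u z => by have := hmU0 u; have := hmUZ0 u z; positivity)
    (fun u => by
      rw [Finset.sum_add_distrib, ← Finset.mul_sum, ← Finset.sum_div, sum_margUY hV', hmsum]
      have : margU pS κ u / margU pS κ u ≤ 1 := div_self_le_one _
      nlinarith) (half_pos hε)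
  refine ⟨max N₀ 1, fun n hn => ?_⟩
  have hn0 : (0 : ℝ) < n := by exact_mod_cast le_of_max_le_right hn
  obtain ⟨f, hfa, hf₁, hf₂⟩ := hN₀ n (le_of_max_le_left hn)
  refine ⟨blockEncoder q f, fun s => prodW_mem_stdSimplex fun i => kernX_mem_stdSimplex hq _ _,
    ?_, ?_⟩
  · rw [mutualInfo_eq_pairMI]
    simp only [law_block_fst]
    have := mul_mean_div hn0 hfa
    linarith
  · rw [mutualInfo_eq_pairMI]
    simp only [law_block_snd]
    have h₁ := mean_div_le hn0 hf₁
    have h₂ := mean_div_le hn0 hf₂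
    -- One encoder satisfies both leakage bounds, so whichever term realises the minimum can be
    -- used.
    rcases min_le_iff.1 hRl with h | h
    · linarith
    · linarith

/-- The trade-off region is closed. -/
lemma isClosed_tradeoffRegion : IsClosed (tradeoffRegion pS W) := by
  refine isClosed_of_closure_subset fun R hR ε hε => ?_
  obtain ⟨R', hR', hd⟩ := Metric.mem_closure_iff.1 hR (ε / 2) (half_pos hε)
  obtain ⟨N₀, hN₀⟩ := hR' (ε / 2) (half_pos hε)
  refine ⟨N₀, fun n hn => ?_⟩
  obtain ⟨e, he, ha, hl⟩ := hN₀ n hn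
  rw [Prod.dist_eq, max_lt_iff, Real.dist_eq, Real.dist_eq] at hd
  have h1 := abs_lt.1 hd.1
  have h2 := abs_lt.1 hd.2
  exact ⟨e, he, by linarith [h1.1, h1.2], by linarith [h2.1, h2.2]⟩

end laws

end

end StateAmp

theorem mainTheorem1 {S X Y Z : Type*} [Fintype S] [Fintype X] [Fintype Y] [Fintype Z]
    (pS : S → ℝ) (hpS : pS ∈ stdSimplex ℝ S)
    (W : X → S → Y × Z → ℝ) (hW : ∀ x s, W x s ∈ stdSimplex ℝ (Y × Z)) :
    StateAmp.regionR3 pS W ⊆ StateAmp.tradeoffRegion pS W := by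
  refine closure_minimal ?_ StateAmp.isClosed_tradeoffRegion
  rintro R ⟨k, q, hq, hR⟩
  exact StateAmp.achievable_of_mem_ratePairs hpS hW hq hR
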